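/- Let $K$ be an algebraically closed field of characteristic zero and let $m,n\ge 1$ be integers. Let $X\subset\mathbf{P}^m\times\mathbf{P}^n$ be a normal hypersurface of bidegree $(1,1)$ over $K$ with defining polynomial $f$. Let $\lambda\colon\mathbf{G}_m\to \mathrm{SL}(m+1)\times \mathrm{SL}(n+1)$ be a one-parameter subgroup which preserves $X$, and let $\alpha\in\mathbf{Z}$ be the weight of $f$ for $\lambda$, i.e. $f(\lambda(t)^{-1}p)=t^{\alpha}f(p)$. Let $d,e$ be positive integers, and let $(\mathcal{X}_\lambda,\mathcal{L}_\lambda)$ be the product test configuration for $(X,\mathcal{O}_X(d,e))$ induced by $\lambda$: $\mathcal{X}_\lambda=X\times\mathbf{A}^1$ with the diagonal action $t\cdot(p,s)=(\lambda(t)p,ts)$, and $\mathcal{L}_\lambda$ is the pull-back of $\mathcal{O}_X(d,e)$ with any $\mathbf{G}_m$-linearization of some power $\mathcal{L}_\lambda^{\otimes r}$, $r\ge 1$, lifting this action. Then its Donaldson–Futaki invariant is $$\mathrm{DF}(\mathcal{X}_\lambda,\mathcal{L}_\lambda)=-\frac{2mnde}{(me+nd)^2}\,\alpha .$$ Here,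 writing $(\mathcal{X}_0,\mathcal{L}_0)$ for the central fibre of $(\mathcal{X}_\lambda,\mathcal{L}_\lambda)$ and $N=\dim X=m+n-1$, one has for all sufficiently divisible positive integers $k$ polynomial expansions $\dim H^0(\mathcal{X}_0,\mathcal{L}_0^{\otimes k})=a_0k^{N}+a_1k^{N-1}+\cdots$ (with $a_0\neq 0$) and $w_k=b_0k^{N+1}+b_1k^{N}+\cdots$, where $w_k$ is the total weight of the induced action $(t\cdot s)(p)=t\cdot s(t^{-1}\cdot p)$ of $\mathbf{G}_m$ on $H^0(\mathcal{X}_0,\mathcal{L}_0^{\otimes k})$, and $\mathrm{DF}=2(a_1b_0-a_0b_1)/a_0^2$. -/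

import Mathlib

namespace BiProj

open MvPolynomial
open scoped Matrix

/-- Homogeneous coordinates on `P^m × P^n`: `x_0, …, x_m` and `y_0, …, y_n`. -/
abbrev Base (m n : ℕ) : Type := Fin (m + 1) ⊕ Fin (n + 1)

/-- Coordinates on `P^m × P^n × A^q`: homogeneous ones for the two projective factors, followed by
`q` affine ones. -/
abbrev Coord (m n q : ℕ) : Type := Base m n ⊕ Fin q

/-- Bidegrees of the homogeneous coordinates: `x_i` has `(1, 0)` and `y_j` has `(0, 1)`. -/
def baseDeg (m n : ℕ) : Base m n → ℕ × ℕ := Sum.elim (fun _ => (1, 0)) (fun _ => (0, 1))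

/-- Bidegrees of all coordinates of `P^m × P^n × A^q`; affine coordinates have bidegree `(0, 0)`. -/
def coordDeg (m n q : ℕ) : Coord m n q → ℕ × ℕ := Sum.elim (baseDeg m n) (fun _ => 0)

section Hypersurface

variable {K : Type*} [Field K] {m n : ℕ}

/-- `f` is the defining polynomial of a hypersurface of bidegree `(1, 1)`. -/
def IsDefining (f : MvPolynomial (Base m n) K) : Prop :=
  f ≠ 0 ∧ IsWeightedHomogeneous (baseDeg m n) f (1, 1)

/-- The set of all homogeneous coordinate vectors `(x, y)`, `x ≠ 0`, `y ≠ 0`, of points of the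
hypersurface `X = {f = 0}` in `P^m × P^n`. A point of `X` is a class of such vectors modulo scaling
`x` and `y` independently. -/
def cone (f : MvPolynomial (Base m n) K) : Set (Base m n → K) :=
  {p | (∃ i, p (Sum.inl i) ≠ 0) ∧ (∃ j, p (Sum.inr j) ≠ 0) ∧ eval p f = 0}

/-- The coordinate ring of the standard affine chart `x_i ≠ 0`, `y_j ≠ 0` of the hypersurface
`X = {f = 0}`, obtained by setting `x_i = y_j = 1`. -/
abbrev ChartRing (f : MvPolynomial (Base m n) K) (i : Fin (m + 1)) (j : Fin (n + 1)) : Type _ :=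
  MvPolynomial (Base m n) K ⧸
    Ideal.span {f, MvPolynomial.X (Sum.inl i) - 1, MvPolynomial.X (Sum.inr j) - 1}

/-- The hypersurface `X = {f = 0}` is normal: all its local rings are integrally closed domains. -/
def IsNormalHypersurface (f : MvPolynomial (Base m n) K) : Prop :=
  ∀ (i : Fin (m + 1)) (j : Fin (n + 1)) (P : Ideal (ChartRing f i j)) [P.IsPrime],
    IsDomain (Localization.AtPrime P) ∧ IsIntegrallyClosed (Localization.AtPrime P)

end Hypersurface

section Sections

variable {K : Type*} [Field K] {m n q : ℕ}

/-- `H^0(Z, O_Z(a, b))` for a (reduced) locally closed `Z ⊆ P^m × P^n × A^q`, where `Z` is given by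
the set of its homogeneous coordinate vectors. A section is a function on these vectors that is,
near every point, a quotient `g / h` of bihomogeneous polynomials whose bidegrees differ by
`(a, b)`. Such a function automatically satisfies `s (u x, v y, z) = u ^ a * v ^ b * s (x, y, z)`. -/
def sections (Z : Set (Coord m n q → K)) (a b : ℕ) : Submodule K (Z → K) where
  carrier := {s | ∀ p : Z, ∃ (c : ℕ × ℕ) (g h : MvPolynomial (Coord m n q) K),
    IsWeightedHomogeneous (coordDeg m n q) g ((a, b) + c) ∧
    IsWeightedHomogeneous (coordDeg m n q) h c ∧
    eval p.1 h ≠ 0 ∧ ∀ p' : Z, eval p'.1 h ≠ 0 → s p' = eval p'.1 g / eval p'.1 h}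
  zero_mem' := fun _ => ⟨0, 0, 1, isWeightedHomogeneous_zero _ _ _, isWeightedHomogeneous_one _ _,
    by simp, by simp⟩
  add_mem' := by
    intro s s' hs hs' p
    obtain ⟨c, g, h, hg, hh, hp, e⟩ := hs p
    obtain ⟨c', g', h', hg', hh', hp', e'⟩ := hs' p
    refine ⟨c + c', g * h' + g' * h, h * h', ?_, hh.mul hh', by simp [hp, hp'], fun x hx => ?_⟩
    · have h1 := hg.mul hh'
      have h2 := hg'.mul hh
      rw [add_assoc] at h1 h2
      rw [add_comm c' c] at h2
      exact h1.add h2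
    · simp only [map_mul, ne_eq, mul_eq_zero, not_or] at hx
      simp only [Pi.add_apply, e x hx.1, e' x hx.2, map_mul, map_add]
      rw [div_add_div _ _ hx.1 hx.2]
      ring
  smul_mem' := by
    intro r s hs p
    obtain ⟨c, g, h, hg, hh, hp, e⟩ := hs p
    refine ⟨c, MvPolynomial.C r * g, h, hg.C_mul r, hh, hp, fun x hx => ?_⟩
    simp only [Pi.smul_apply, smul_eq_mul, e x hx, map_mul, eval_C]
    ring

theorem sections_mul {Z : Set (Coord m n q → K)} {a b a' b' : ℕ} {s s' : Z → K}
    (hs : s ∈ sections Z a b) (hs' : s' ∈ sections Z a' b') :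
    s * s' ∈ sections Z (a + a') (b + b') := by
  intro p
  obtain ⟨c, g, h, hg, hh, hp, e⟩ := hs p
  obtain ⟨c', g', h', hg', hh', hp', e'⟩ := hs' p
  refine ⟨c + c', g * g', h * h', ?_, hh.mul hh', by simp [hp, hp'], fun x hx => ?_⟩
  · have h1 := hg.mul hg'
    rwa [add_add_add_comm] at h1
  · simp only [map_mul, ne_eq, mul_eq_zero, not_or] at hx
    simp only [Pi.mul_apply, e x hx.1, e' x hx.2, map_mul]
    rw [div_mul_div_comm]

theorem sections_pow_mul {Z : Set (Coord m n q → K)} {a b : ℕ} {c s : Z → K}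
    (hc : c ∈ sections Z 0 0) (hs : s ∈ sections Z a b) (j : ℕ) :
    c ^ j * s ∈ sections Z a b := by
  induction j with
  | zero => simpa using hs
  | succ j ih =>
    have h := sections_mul hc ih
    rwa [zero_add, zero_add, ← mul_assoc, ← pow_succ'] at h

theorem isWeightedHomogeneous_bind {σ τ : Type*} {w : σ → ℕ × ℕ} {w' : τ → ℕ × ℕ}
    {φ : σ → MvPolynomial τ K} (hφ : ∀ i, IsWeightedHomogeneous w' (φ i) (w i))
    {g : MvPolynomial σ K} {c : ℕ × ℕ} (hg : IsWeightedHomogeneous w g c) :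
    IsWeightedHomogeneous w' (bind₁ φ g) c := by
  classical
  rw [← mem_weightedHomogeneousSubmodule]
  have key : bind₁ φ g = ∑ d ∈ g.support, MvPolynomial.C (coeff d g) *
      ∏ i ∈ d.support, φ i ^ d i := by
    conv_lhs => rw [g.as_sum]
    rw [map_sum]
    exact Finset.sum_congr rfl fun d _ => bind₁_monomial _ _ _
  rw [key]
  refine Submodule.sum_mem _ fun d hd => ?_
  rw [mem_weightedHomogeneousSubmodule]
  refine IsWeightedHomogeneous.C_mul ?_ _
  have h := IsWeightedHomogeneous.prod d.support (fun i => φ i ^ d i) (fun i => d i • w i)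
    (fun i _ => (hφ i).pow (d i))
  rwa [show ∑ i ∈ d.support, d i • w i = c from hg (mem_support_iff.mp hd)] at h

/-- Sections pull back along maps that are given by polynomials of the right bidegrees. -/
theorem sections_comp {q' : ℕ} {Z : Set (Coord m n q → K)} {Z' : Set (Coord m n q' → K)}
    {a b : ℕ} (φ : Coord m n q' → MvPolynomial (Coord m n q) K)
    (hφ : ∀ i, IsWeightedHomogeneous (coordDeg m n q) (φ i) (coordDeg m n q' i))
    (Φ : Z → Z') (hΦ : ∀ p i, (Φ p).1 i = eval p.1 (φ i)) {s : Z' → K}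
    (hs : s ∈ sections Z' a b) : (fun p => s (Φ p)) ∈ sections Z a b := by
  have hev : ∀ (p : Z) (g : MvPolynomial (Coord m n q') K),
      eval p.1 (bind₁ φ g) = eval (Φ p).1 g := by
    intro p g
    rw [← coe_aeval_eq_eval, RingHom.coe_coe, aeval_bind₁, ← coe_aeval_eq_eval, RingHom.coe_coe]
    congr 2
    funext i
    rw [hΦ, ← coe_aeval_eq_eval, RingHom.coe_coe]
  intro p
  obtain ⟨c, g, h, hg, hh, hp, e⟩ := hs (Φ p)
  refine ⟨c, bind₁ φ g, bind₁ φ h, isWeightedHomogeneous_bind hφ hg,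
    isWeightedHomogeneous_bind hφ hh, by rwa [hev], fun x hx => ?_⟩
  rw [hev] at hx
  rw [hev, hev]
  exact e _ hx

end Sections

section Action

variable {K : Type*} [Field K] {m n : ℕ}

/-- A one-parameter subgroup of `SL(m+1) × SL(n+1)`: a homomorphism from `G_m` whose matrix entries
are Laurent polynomials in `t`. -/
structure OneParameterSubgroup (K : Type*) [Field K] (m n : ℕ) where
  /-- the underlying homomorphism on points -/
  toHom : Kˣ →*
    Matrix.SpecialLinearGroup (Fin (m + 1)) K × Matrix.SpecialLinearGroup (Fin (n + 1)) K
  algebraic_left : ∀ i j, ∃ g : LaurentPolynomial K, ∀ t : Kˣ,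
    (toHom t).1.1 i j = LaurentPolynomial.eval₂ (RingHom.id K) t g
  algebraic_right : ∀ i j, ∃ g : LaurentPolynomial K, ∀ t : Kˣ,
    (toHom t).2.1 i j = LaurentPolynomial.eval₂ (RingHom.id K) t g

/-- The linear action of `λ(t)` on homogeneous coordinate vectors `(x, y)` of `P^m × P^n`. -/
def act (l : OneParameterSubgroup K m n) (t : Kˣ) (p : Base m n → K) : Base m n → K :=
  Sum.elim ((l.toHom t).1.1 *ᵥ fun i => p (Sum.inl i)) ((l.toHom t).2.1 *ᵥ fun j => p (Sum.inr j))

/-- `λ` preserves the hypersurface `X = {f = 0}`. -/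
def Preserves (l : OneParameterSubgroup K m n) (f : MvPolynomial (Base m n) K) : Prop :=
  ∀ (t : Kˣ), ∀ p ∈ cone f, act l t p ∈ cone f

/-- `f` has weight `α` for `λ`: `λ(t) · f = t ^ α f`, where `G_m` acts on polynomial functions by
`(λ(t) · f)(p) = f(λ(t)⁻¹ p)`. -/
def HasWeight (l : OneParameterSubgroup K m n) (f : MvPolynomial (Base m n) K) (α : ℤ) : Prop :=
  ∀ (t : Kˣ) (p : Base m n → K), eval (act l t⁻¹ p) f = ((t ^ α : Kˣ) : K) * eval p f

theorem act_one (l : OneParameterSubgroup K m n) (p : Base m n → K) : act l 1 p = p := by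
  funext i
  rcases i with i | i <;> simp [act]

theorem act_mul (l : OneParameterSubgroup K m n) (t t' : Kˣ) (p : Base m n → K) :
    act l (t * t') p = act l t (act l t' p) := by
  funext i
  rcases i with i | i <;> simp [act, Matrix.mulVec_mulVec]

end Action

section TestConfiguration

variable {K : Type*} [Field K] {m n : ℕ}

/-- The total space `𝒳 = X × A^1` of the product test configuration, for `X = {f = 0}`, as the set
of its coordinate vectors `(x, y, s)`; the map to `A^1` is the coordinate `s`. -/
def total (f : MvPolynomial (Base m n) K) : Set (Coord m n 1 → K) :=
  {p | (fun i => p (Sum.inl i)) ∈ cone f}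

/-- The central fibre `𝒳_0 = {s = 0}`. -/
def central (f : MvPolynomial (Base m n) K) : Set (Coord m n 1 → K) :=
  {p | p ∈ total f ∧ p (Sum.inr 0) = 0}

/-- The diagonal action `(x, y, s) ↦ (λ(t) (x, y), t s)`. -/
def actTotal (l : OneParameterSubgroup K m n) (t : Kˣ) (p : Coord m n 1 → K) : Coord m n 1 → K :=
  Sum.elim (act l t fun i => p (Sum.inl i)) (fun i => (t : K) * p (Sum.inr i))

theorem actTotal_one (l : OneParameterSubgroup K m n) (p : Coord m n 1 → K) :
    actTotal l 1 p = p := by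
  funext i
  rcases i with i | i <;> simp [actTotal, act_one]

theorem actTotal_mul (l : OneParameterSubgroup K m n) (t t' : Kˣ) (p : Coord m n 1 → K) :
    actTotal l (t * t') p = actTotal l t (actTotal l t' p) := by
  funext i
  rcases i with i | i <;> simp [actTotal, act_mul, mul_assoc]

/-- The action on `𝒳`. -/
def smulTotal {l : OneParameterSubgroup K m n} {f : MvPolynomial (Base m n) K}
    (hl : Preserves l f) (t : Kˣ) (p : total f) : total f :=
  ⟨actTotal l t p.1, show act l t (fun i => p.1 (Sum.inl i)) ∈ cone f from hl t _ p.2⟩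

/-- The action on the central fibre `𝒳_0`. -/
def smulCentral {l : OneParameterSubgroup K m n} {f : MvPolynomial (Base m n) K}
    (hl : Preserves l f) (t : Kˣ) (p : central f) : central f :=
  ⟨actTotal l t p.1, show act l t (fun i => p.1 (Sum.inl i)) ∈ cone f from hl t _ p.2.1,
    by simp [actTotal, p.2.2]⟩

/-- The inclusion `𝒳_0 ⊆ 𝒳`. -/
def inclCentral (f : MvPolynomial (Base m n) K) (p : central f) : total f := ⟨p.1, p.2.1⟩

/-- `G_m × 𝒳`, as the set of its coordinate vectors `(x, y, s, t)`, `t ≠ 0`. -/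
def gmTotal (f : MvPolynomial (Base m n) K) : Set (Coord m n 2 → K) :=
  {p | (fun i => p (Sum.inl i)) ∈ cone f ∧ p (Sum.inr 1) ≠ 0}

/-- The projection `G_m × 𝒳 → 𝒳`. -/
def gmSnd (f : MvPolynomial (Base m n) K) (p : gmTotal f) : total f :=
  ⟨Sum.elim (fun i => p.1 (Sum.inl i)) (fun _ => p.1 (Sum.inr 0)), p.2.1⟩

/-- A `G_m`-linearization of a line bundle `pr_1^* O_X(a, b)` on `𝒳 = X × A^1` lifting the diagonal
action. Points of its total space are classes `[p, z]` with `p` a coordinate vector of a point of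
`𝒳` and `z` a scalar. A lift of the action of `t` that is linear on the fibres is
`[p, z] ↦ [λ(t) p, c(t, p) z]`, where `c(t, p)` depends only on the point of `𝒳` that `p`
represents, and is regular on `G_m × 𝒳`; it is an action when `c` is a multiplicative cocycle.
The choice `c = 1` is the standard linearization through the linear action of
`SL(m+1) × SL(n+1)`; the description does not depend on `(a, b)`. -/
structure Linearization {l : OneParameterSubgroup K m n} {f : MvPolynomial (Base m n) K}
    (hl : Preserves l f) where
  /-- the multiplier -/
  c : Kˣ → total f → K
  map_one : ∀ p, c 1 p = 1
  map_mul : ∀ t t' p, c (t * t') p = c t (smulTotal hl t' p) * c t' p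
  regular : (fun p : gmTotal f => c (Units.mk0 (p.1 (Sum.inr 1)) p.2.2) (gmSnd f p)) ∈
    sections (gmTotal f) 0 0

theorem linearization_regular {l : OneParameterSubgroup K m n} {f : MvPolynomial (Base m n) K}
    {hl : Preserves l f} (L : Linearization hl) (t : Kˣ) :
    (fun p : central f => L.c t (inclCentral f p)) ∈ sections (central f) 0 0 := by
  have h := sections_comp (Z := central f) (Z' := gmTotal f)
    (Sum.elim (fun i => MvPolynomial.X (Sum.inl i))
      (fun i => if i = 0 then MvPolynomial.X (Sum.inr 0) else MvPolynomial.C (t : K)))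
    ?_ (fun p => ⟨Sum.elim (fun i => p.1 (Sum.inl i))
      (fun i => if i = 0 then p.1 (Sum.inr 0) else (t : K)), p.2.1, by simp⟩) ?_ L.regular
  · convert h using 3 with p
    · ext; simp
    · apply Subtype.ext
      funext i
      rcases i with i | i
      · rfl
      · fin_cases i; rfl
  · rintro (i | i)
    · exact isWeightedHomogeneous_X _ _ _
    · dsimp only [Sum.elim_inr]
      split_ifs
      · exact isWeightedHomogeneous_X _ _ _
      · exact isWeightedHomogeneous_C _ _
  · rintro p (i | i)
    · simp
    · by_cases hi : i = 0 <;> simp [hi]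

theorem sections_smulCentral {l : OneParameterSubgroup K m n} {f : MvPolynomial (Base m n) K}
    (hl : Preserves l f) (t : Kˣ) {a b : ℕ} {s : central f → K}
    (hs : s ∈ sections (central f) a b) :
    (fun p => s (smulCentral hl t p)) ∈ sections (central f) a b := by
  refine sections_comp (Sum.elim (Sum.elim
      (fun i => ∑ k, MvPolynomial.C ((l.toHom t).1.1 i k) * MvPolynomial.X (Sum.inl (Sum.inl k)))
      (fun i => ∑ k, MvPolynomial.C ((l.toHom t).2.1 i k) * MvPolynomial.X (Sum.inl (Sum.inr k))))
    (fun i => MvPolynomial.C (t : K) * MvPolynomial.X (Sum.inr i))) ?_ _ ?_ hs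
  · rintro ((i | i) | i)
    · exact IsWeightedHomogeneous.sum Finset.univ (fun k => MvPolynomial.C ((l.toHom t).1.1 i k) *
          MvPolynomial.X (Sum.inl (Sum.inl k))) (1, 0) fun k _ =>
        (isWeightedHomogeneous_X K (coordDeg m n 1) (Sum.inl (Sum.inl k))).C_mul _
    · exact IsWeightedHomogeneous.sum Finset.univ (fun k => MvPolynomial.C ((l.toHom t).2.1 i k) *
          MvPolynomial.X (Sum.inl (Sum.inr k))) (0, 1) fun k _ =>
        (isWeightedHomogeneous_X K (coordDeg m n 1) (Sum.inl (Sum.inr k))).C_mul _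
    · exact (isWeightedHomogeneous_X K (coordDeg m n 1) (Sum.inr i)).C_mul _
  · rintro p ((i | i) | i) <;>
      simp [smulCentral, actTotal, act, Matrix.mulVec, dotProduct]

/-- For a linearization `L` of `ℒ^r`, the representation of `G_m` induced by `L^j` on
`H^0(𝒳_0, O(a, b))`, where `O(a, b) = (ℒ_0^r)^j`: the action
`(t · s)(p) = t · s(t⁻¹ · p) = c(t, t⁻¹ p) ^ j * s(t⁻¹ p)`. -/
noncomputable def sectionRep {l : OneParameterSubgroup K m n} {f : MvPolynomial (Base m n) K}
    {hl : Preserves l f} (L : Linearization hl) (j a b : ℕ) :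
    Representation K Kˣ (sections (central f) a b) where
  toFun t :=
    { toFun := fun s => ⟨fun p => L.c t (inclCentral f (smulCentral hl t⁻¹ p)) ^ j *
          s.1 (smulCentral hl t⁻¹ p),
        sections_smulCentral hl t⁻¹ (sections_pow_mul (linearization_regular L t) s.2 j)⟩
      map_add' := fun s s' => by
        apply Subtype.ext
        funext p
        simp [mul_add]
      map_smul' := fun r s => by
        apply Subtype.ext
        funext p
        simp [mul_left_comm] }
  map_one' := by
    ext s p
    have hp : smulCentral hl 1 p = p := Subtype.ext (actTotal_one l p.1)
    simp [hp, L.map_one]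
  map_mul' := by
    intro t t'
    ext s p
    have h1 : smulCentral hl (t * t')⁻¹ p = smulCentral hl t'⁻¹ (smulCentral hl t⁻¹ p) :=
      Subtype.ext (by rw [mul_inv_rev]; exact actTotal_mul l _ _ p.1)
    have h2 : smulTotal hl t' (inclCentral f (smulCentral hl t'⁻¹ (smulCentral hl t⁻¹ p))) =
        inclCentral f (smulCentral hl t⁻¹ p) := by
      apply Subtype.ext
      change actTotal l t' (actTotal l t'⁻¹ _) = _
      rw [← actTotal_mul, mul_inv_cancel, actTotal_one]
      rfl
    simp only [LinearMap.coe_mk, AddHom.coe_mk, Module.End.mul_apply]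
    rw [h1, L.map_mul, h2, mul_pow, mul_assoc]

end TestConfiguration

section DonaldsonFutaki

/-- The space of vectors of weight `μ` of a representation of `G_m`. -/
def weightSpace {K M : Type*} [Field K] [AddCommGroup M] [Module K M]
    (ρ : Representation K Kˣ M) (μ : ℤ) : Submodule K M where
  carrier := {v | ∀ t : Kˣ, ρ t v = ((t ^ μ : Kˣ) : K) • v}
  zero_mem' := by simp
  add_mem' := fun hv hw t => by rw [map_add, hv t, hw t, smul_add]
  smul_mem' := fun r v hv t => by rw [map_smul, hv t, smul_comm]

/-- The total weight of a finite-dimensional representation of `G_m`: the sum of its weights,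
counted with multiplicities. -/
noncomputable def totalWeight {K M : Type*} [Field K] [AddCommGroup M] [Module K M]
    (ρ : Representation K Kˣ M) : ℤ :=
  ∑ᶠ μ : ℤ, μ * (Module.finrank K (weightSpace ρ μ) : ℤ)

/-- `D` is the Donaldson–Futaki invariant `2 (a₁ b₀ - a₀ b₁) / a₀²` that belongs to a polarized
variety of dimension `δ` with `N k = a₀ k ^ δ + a₁ k ^ (δ - 1) + ⋯` and
`w k = b₀ k ^ (δ + 1) + b₁ k ^ δ + ⋯` for all sufficiently divisible positive `k`. -/
def IsDonaldsonFutaki (δ : ℕ) (N : ℕ → ℕ) (w : ℕ → ℤ) (D : ℚ) : Prop :=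
  ∃ P Q : Polynomial ℚ, P.natDegree ≤ δ ∧ Q.natDegree ≤ δ + 1 ∧
    (∃ k₀ > 0, ∀ k > 0, k₀ ∣ k → (N k : ℚ) = P.eval (k : ℚ) ∧ (w k : ℚ) = Q.eval (k : ℚ)) ∧
    P.coeff δ ≠ 0 ∧
    D = 2 * (P.coeff (δ - 1) * Q.coeff (δ + 1) - P.coeff δ * Q.coeff δ) / P.coeff δ ^ 2

variable {K : Type*} [Field K] {m n : ℕ}

/-- `D` is the Donaldson–Futaki invariant of the product test configuration `(𝒳_λ, ℒ_λ)` for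
`(X, O_X(d, e))` with `𝒳_λ = X × A^1`, the diagonal action, and `ℒ_λ` the pull-back of `O_X(d, e)`,
where `L` is the chosen linearization of `ℒ_λ^r`. Here `X` has dimension `m + n - 1`, `N k` is the
dimension of `H^0(𝒳_0, ℒ_0^k)`, and for `k` divisible by `r`, `w k` is the total weight of
`H^0(𝒳_0, ℒ_0^k)` for the linearization `L^(k / r)`. -/
def ProductDF {l : OneParameterSubgroup K m n} {f : MvPolynomial (Base m n) K}
    {hl : Preserves l f} (d e r : ℕ) (L : Linearization hl) (D : ℚ) : Prop :=
  IsDonaldsonFutaki (m + n - 1)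
    (fun k => Module.finrank K (sections (central f) (d * k) (e * k)))
    (fun k => totalWeight (sectionRep L (k / r) (d * k) (e * k))) D

end DonaldsonFutaki

end BiProj

/-!
Write `S` for the polynomial ring in the coordinates `x_0, …, x_m, y_0, …, y_n`. The proof computes
the representation of `G_m` on `H^0(X, O(a, b))` exactly, for all `a, b ≥ 1`.

*Sections are polynomials.* A normal `X` is irreducible, because the two components of a product of
linear forms in `x` and in `y` meet (`irreducible_of_isNormalHypersurface`). So `f` is prime, and by
the Nullstellensatz a polynomial vanishes on `X` exactly when `f` divides it. A section of
`O(a, b)` on `X` is a single fraction `F / H` modulo `f`, and the ideal of all `u` for which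
`u F / H` is a polynomial modulo `f` contains a power of `(x_0, …, x_m) (y_0, …, y_n)`. The powers
are removed one at a time (`mul_mem_span_of_forall_X_mul`), which replaces the vanishing of
`H^1(P^m × P^n, O(a - 1, b - 1))` for `a, b ≥ 0`. The result is
`H^0(X, O(a, b)) = S_(a, b) / f S_(a - 1, b - 1)`, in `exists_restrict_eq`.

*Weights.* In suitable linear coordinates `λ` is diagonal (`exists_diagonalization`). If `D` is
the leading exponent of `f` in these coordinates, the monomials not divisible by that of exponent
`D` form an eigenbasis of the sections (`exists_basis_sections`). The weights of `λ` add up to zero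
on each factor, hence so do the weights of all monomials of a given bidegree; the monomial of
exponent `D` has the weight `α` of `f`. A linearization differs from the standard one, on the
central fibre, by a character `t ^ γ` (`exists_multiplier_eq_zpow`), since its multiplier is
a section of `O_X` and hence constant along `X`. With
`h(a, b) = dim S_(a, b)` this gives (`finrank_and_totalWeight`)

  `dim H^0(𝒳_0, ℒ_0 ^ k) = h(d k, e k) - h(d k - 1, e k - 1)`,
  `w_k = γ (k / r) dim H^0(𝒳_0, ℒ_0 ^ k) - α h(d k - 1, e k - 1)`.

*Asymptotics.* The term with `γ` changes `b_0`, `b_1` by the same multiple of `a_0`, `a_1` and so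
does not contribute; the rest is a computation with the two leading coefficients of products of
linear factors (`isDonaldsonFutaki_of_eq`).
-/

namespace BiProj

open MvPolynomial
open scoped Matrix

/-! ### Factors of weighted-homogeneous polynomials -/

section Homogeneous

variable {K σ : Type*} [Field K]

/-- The homomorphism `X_i ↦ X_i T ^ (w i)` to polynomials in `T`. Its coefficient of `T ^ k` is
the component of weight `k`, so that a polynomial is homogeneous exactly when its image is a
monomial in `T`. -/
noncomputable def weightExpand (w : σ → ℕ) :
    MvPolynomial σ K →ₐ[K] Polynomial (MvPolynomial σ K) :=
  aeval fun i => Polynomial.C (X i) * Polynomial.X ^ w i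

theorem weightExpand_monomial (w : σ → ℕ) (u : σ →₀ ℕ) (c : K) :
    weightExpand w (monomial u c) =
      Polynomial.C (monomial u c) * Polynomial.X ^ Finsupp.weight w u := by
  rw [weightExpand, aeval_monomial, monomial_eq, Finsupp.weight_apply]
  simp only [Finsupp.prod, Finsupp.sum, mul_pow, Finset.prod_mul_distrib, map_mul, map_prod,
    map_pow, smul_eq_mul, ← pow_mul, mul_comm (w _), Finset.prod_pow_eq_pow_sum]
  rw [mul_assoc]
  rfl

theorem coeff_weightExpand (w : σ → ℕ) (g : MvPolynomial σ K) (k : ℕ) :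
    (weightExpand w g).coeff k = weightedHomogeneousComponent w k g := by
  classical
  ext u
  rw [coeff_weightedHomogeneousComponent]
  induction g using MvPolynomial.induction_on' with
  | monomial v c =>
    rw [weightExpand_monomial, Polynomial.coeff_C_mul_X_pow, coeff_monomial]
    by_cases h : v = u
    · subst h
      by_cases h' : k = Finsupp.weight w v
      · simp [h']
      · simp [h', Ne.symm h']
    · split_ifs <;> simp [coeff_monomial, h]
  | add p q hp hq =>
    rw [map_add, Polynomial.coeff_add, coeff_add, hp, hq, coeff_add]
    split_ifs <;> simp

theorem weightExpand_of_isWeightedHomogeneous {w : σ → ℕ} {g : MvPolynomial σ K} {k : ℕ}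
    (hg : IsWeightedHomogeneous w g k) :
    weightExpand w g = Polynomial.C g * Polynomial.X ^ k := by
  classical
  ext i u
  rw [coeff_weightExpand, coeff_weightedHomogeneousComponent, Polynomial.coeff_C_mul_X_pow]
  by_cases h : coeff u g = 0
  · split_ifs <;> simp [h]
  · rw [hg h]
    by_cases hk : k = i
    · simp [hk]
    · simp [hk, Ne.symm hk]

theorem isWeightedHomogeneous_factors {w : σ → ℕ} {g h : MvPolynomial σ K} {n : ℕ}
    (hgh : IsWeightedHomogeneous w (g * h) n) (hne : g * h ≠ 0) :
    ∃ k l, k + l = n ∧ IsWeightedHomogeneous w g k ∧ IsWeightedHomogeneous w h l := by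
  classical
  have inj : ∀ q : MvPolynomial σ K, q ≠ 0 → weightExpand w q ≠ 0 := by
    intro q hq h0
    obtain ⟨u, hu⟩ := ne_zero_iff.mp hq
    have := congrArg (coeff u) (coeff_weightExpand w q (Finsupp.weight w u))
    rw [h0, coeff_weightedHomogeneousComponent, if_pos rfl] at this
    exact hu (by simpa using this.symm)
  have e := weightExpand_of_isWeightedHomogeneous hgh
  rw [map_mul] at e
  have hg := inj g (left_ne_zero_of_mul hne)
  have hh := inj h (right_ne_zero_of_mul hne)
  have e1 := congrArg Polynomial.natDegree e
  have e2 := congrArg Polynomial.natTrailingDegree e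
  rw [Polynomial.natDegree_mul hg hh, Polynomial.natDegree_C_mul_X_pow _ _ hne] at e1
  rw [Polynomial.natTrailingDegree_mul hg hh, Polynomial.C_mul_X_pow_eq_monomial,
    Polynomial.natTrailingDegree_monomial hne] at e2
  have key : ∀ q : MvPolynomial σ K,
      (weightExpand w q).natTrailingDegree = (weightExpand w q).natDegree →
      IsWeightedHomogeneous w q (weightExpand w q).natDegree := by
    intro q hq u hu
    have hc : (weightExpand w q).coeff (Finsupp.weight w u) ≠ 0 := by
      intro h0
      have := congrArg (coeff u) (coeff_weightExpand w q (Finsupp.weight w u))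
      rw [h0, coeff_weightedHomogeneousComponent, if_pos rfl] at this
      exact hu (by simpa using this.symm)
    have h1 := Polynomial.le_natDegree_of_ne_zero hc
    have h2 := Polynomial.natTrailingDegree_le_of_ne_zero hc
    omega
  have l1 := (weightExpand w g).natTrailingDegree_le_natDegree
  have l2 := (weightExpand w h).natTrailingDegree_le_natDegree
  exact ⟨_, _, e1, key g (by omega), key h (by omega)⟩

end Homogeneous

/-! ### A normal hypersurface of bidegree `(1, 1)` is irreducible -/

section Irreducible

variable {K : Type*} [Field K] {m n : ℕ}

theorem weight_baseDeg (u : Base m n →₀ ℕ) :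
    Finsupp.weight (baseDeg m n) u =
      (Finsupp.weight (fun i => (baseDeg m n i).1) u,
        Finsupp.weight (fun i => (baseDeg m n i).2) u) := by
  simp only [Finsupp.weight_apply, Finsupp.sum]
  ext
  · simp [Prod.fst_sum]
  · simp [Prod.snd_sum]

theorem isWeightedHomogeneous_baseDeg {g : MvPolynomial (Base m n) K} {a b : ℕ} :
    IsWeightedHomogeneous (baseDeg m n) g (a, b) ↔
      IsWeightedHomogeneous (fun i => (baseDeg m n i).1) g a ∧
        IsWeightedHomogeneous (fun i => (baseDeg m n i).2) g b := by
  simp only [IsWeightedHomogeneous, weight_baseDeg, Prod.mk.injEq]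
  exact ⟨fun h => ⟨fun _ hd => (h hd).1, fun _ hd => (h hd).2⟩,
    fun h _ hd => ⟨h.1 hd, h.2 hd⟩⟩

theorem weight_fst (u : Base m n →₀ ℕ) :
    Finsupp.weight (fun i => (baseDeg m n i).1) u = ∑ i, u (Sum.inl i) := by
  rw [Finsupp.weight_apply, Finsupp.sum_fintype _ _ (by simp)]
  simp [baseDeg]

theorem weight_snd (u : Base m n →₀ ℕ) :
    Finsupp.weight (fun i => (baseDeg m n i).2) u = ∑ j, u (Sum.inr j) := by
  rw [Finsupp.weight_apply, Finsupp.sum_fintype _ _ (by simp)]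
  simp [baseDeg]

theorem weight_eq_iff (u : Base m n →₀ ℕ) (a b : ℕ) :
    Finsupp.weight (baseDeg m n) u = (a, b) ↔
      ∑ i, u (Sum.inl i) = a ∧ ∑ j, u (Sum.inr j) = b := by
  rw [weight_baseDeg, weight_fst, weight_snd, Prod.mk.injEq]

theorem degree_eq_of_weight {u : Base m n →₀ ℕ} {a b : ℕ}
    (h : Finsupp.weight (baseDeg m n) u = (a, b)) : u.degree = a + b := by
  rw [weight_eq_iff] at h
  rw [Finsupp.degree_eq_sum, Fintype.sum_sum_type, h.1, h.2]

theorem exists_single_of_weight_fst {u : Base m n →₀ ℕ}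
    (h : Finsupp.weight (baseDeg m n) u = (1, 0)) : ∃ i, u = Finsupp.single (Sum.inl i) 1 := by
  have h1 := degree_eq_of_weight h
  obtain ⟨k, rfl⟩ := (Finsupp.sum_eq_one_iff u).mp h1
  rcases k with i | j
  · exact ⟨i, rfl⟩
  · simp [Finsupp.weight_single, baseDeg] at h

theorem exists_single_of_weight_snd {u : Base m n →₀ ℕ}
    (h : Finsupp.weight (baseDeg m n) u = (0, 1)) : ∃ j, u = Finsupp.single (Sum.inr j) 1 := by
  have h1 := degree_eq_of_weight h
  obtain ⟨k, rfl⟩ := (Finsupp.sum_eq_one_iff u).mp h1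
  rcases k with i | j
  · simp [Finsupp.weight_single, baseDeg] at h
  · exact ⟨j, rfl⟩

/-- The linear form with the given coefficients. -/
noncomputable def linearForm (u : Base m n → K) : MvPolynomial (Base m n) K :=
  ∑ k, C (u k) * X k

theorem eq_linearForm {g : MvPolynomial (Base m n) K}
    (hg : ∀ u, coeff u g ≠ 0 → ∃ k, u = Finsupp.single k 1) :
    g = linearForm fun k => coeff (Finsupp.single k 1) g := by
  classical
  ext u
  simp only [linearForm, coeff_sum, coeff_C_mul, coeff_X]
  by_cases h : ∃ k, u = Finsupp.single k 1
  · obtain ⟨k, rfl⟩ := h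
    simp [Finsupp.single_left_inj]
  · rw [not_imp_comm.mp (hg u) h, Finset.sum_eq_zero]
    intro k _
    rw [if_neg fun e => h ⟨k, e.symm⟩, mul_zero]

/-- Let `p` be a common zero of the linear forms `u` and `v`, and let `f` be their product. Then
the form `u` is not killed, in the chart of `f` around `p`, by a function `s` with `s(p) ≠ 0`: on the
line through `p` in the direction of `k`, `f` vanishes and `u` does not. -/
theorem smul_linearForm_notMem {u v p : Base m n → K} {i : Fin (m + 1)} {j : Fin (n + 1)}
    {k : Base m n} (hu : ∑ l, u l * p l = 0) (hv : ∑ l, v l * p l = 0)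
    (hi : p (Sum.inl i) = 1) (hj : p (Sum.inr j) = 1)
    (hki : k ≠ Sum.inl i) (hkj : k ≠ Sum.inr j) (huk : u k ≠ 0) (hvk : v k = 0)
    {s : MvPolynomial (Base m n) K} (hs : eval p s ≠ 0) :
    s * linearForm u ∉ Ideal.span {linearForm u * linearForm v,
      MvPolynomial.X (Sum.inl i) - 1, MvPolynomial.X (Sum.inr j) - 1} := by
  classical
  intro hmem
  let Θ : MvPolynomial (Base m n) K →ₐ[K] Polynomial K :=
    aeval fun l => Polynomial.C (p l) +
      Polynomial.C (Pi.single (M := fun _ => K) k 1 l) * Polynomial.X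
  have hlin : ∀ a : Base m n → K, Θ (linearForm a) =
      Polynomial.C (∑ l, a l * p l) + Polynomial.C (a k) * Polynomial.X := by
    intro a
    simp only [Θ, linearForm, map_sum, map_mul, aeval_X, algHom_C, mul_add,
      Finset.sum_add_distrib, Polynomial.algebraMap_eq]
    congr 1
    rw [Finset.sum_eq_single k]
    · simp
    · intro l _ hl
      simp [hl]
    · simp
  have h0 : Θ (s * linearForm u) = 0 := by
    have : Ideal.span {linearForm u * linearForm v,
      MvPolynomial.X (Sum.inl i) - 1, MvPolynomial.X (Sum.inr j) - 1} ≤ RingHom.ker Θ := by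
      rw [Ideal.span_le]
      rintro q (rfl | rfl | rfl)
      · simp [RingHom.mem_ker, hlin, hv, hvk]
      · simp [RingHom.mem_ker, Θ, hi, Pi.single_apply, hki.symm]
      · simp [RingHom.mem_ker, Θ, hj, Pi.single_apply, hkj.symm]
    exact this hmem
  rw [map_mul, hlin, hu, map_zero, zero_add, mul_eq_zero] at h0
  rcases h0 with h0 | h0
  · apply hs
    have : (Polynomial.aeval (0 : K)).comp Θ = aeval p := by
      ext l
      simp [Θ]
    rw [← coe_aeval_eq_eval, RingHom.coe_coe, ← this, AlgHom.comp_apply, h0, map_zero]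
  · simp [huk] at h0

theorem exists_ne_zero_dotProduct_eq_zero {k : ℕ} (hk : 1 ≤ k) (u : Fin (k + 1) → K) :
    ∃ x : Fin (k + 1) → K, (∃ i, x i ≠ 0) ∧ ∑ i, u i * x i = 0 := by
  let φ : (Fin (k + 1) → K) →ₗ[K] K := ∑ i, u i • LinearMap.proj i
  have hφ : LinearMap.ker φ ≠ ⊥ := LinearMap.ker_ne_bot_of_finrank_lt (by simp; omega)
  obtain ⟨x, hx, hx0⟩ := Submodule.exists_mem_ne_zero_of_ne_bot hφ
  refine ⟨x, Function.ne_iff.mp hx0, ?_⟩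
  simpa [φ, LinearMap.sum_apply] using hx

theorem exists_ne_coeff_ne_zero {k : ℕ} {u x : Fin (k + 1) → K} (hu : ∃ i, u i ≠ 0)
    (hux : ∑ i, u i * x i = 0) {i : Fin (k + 1)} (hi : x i ≠ 0) : ∃ l, l ≠ i ∧ u l ≠ 0 := by
  by_contra! h
  have h1 : ∑ l, u l * x l = u i * x i :=
    Finset.sum_eq_single i (fun l _ hl => by rw [h l hl, zero_mul]) (by simp)
  obtain ⟨l, hl⟩ := hu
  by_cases hli : l = i
  · subst hli
    exact (mul_ne_zero hl hi) (h1 ▸ hux)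
  · exact hl (h l hli)

/-- The product of a linear form in `x` and one in `y` does not define a normal hypersurface: its
two components meet. -/
theorem not_isNormalHypersurface_mul (hm : 1 ≤ m) (hn : 1 ≤ n)
    {g h : MvPolynomial (Base m n) K} (hg : IsWeightedHomogeneous (baseDeg m n) g (1, 0))
    (hh : IsWeightedHomogeneous (baseDeg m n) h (0, 1)) (hg0 : g ≠ 0) (hh0 : h ≠ 0) :
    ¬ IsNormalHypersurface (g * h) := by
  classical
  intro hX
  obtain ⟨u, hu, rfl, hul⟩ : ∃ u : Base m n → K, (∃ i, u (Sum.inl i) ≠ 0) ∧ g = linearForm u ∧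
      ∀ j, u (Sum.inr j) = 0 := by
    refine ⟨fun k => coeff (Finsupp.single k 1) g, ?_, eq_linearForm ?_, ?_⟩
    · obtain ⟨d, hd⟩ := ne_zero_iff.mp hg0
      obtain ⟨i, rfl⟩ := exists_single_of_weight_fst (hg hd)
      exact ⟨i, hd⟩
    · intro d hd
      obtain ⟨i, rfl⟩ := exists_single_of_weight_fst (hg hd)
      exact ⟨_, rfl⟩
    · intro j
      apply hg.coeff_eq_zero
      simp [Finsupp.weight_single, baseDeg]
  obtain ⟨v, hv, rfl, hvl⟩ : ∃ u : Base m n → K, (∃ i, u (Sum.inr i) ≠ 0) ∧ h = linearForm u ∧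
      ∀ j, u (Sum.inl j) = 0 := by
    refine ⟨fun k => coeff (Finsupp.single k 1) h, ?_, eq_linearForm ?_, ?_⟩
    · obtain ⟨d, hd⟩ := ne_zero_iff.mp hh0
      obtain ⟨i, rfl⟩ := exists_single_of_weight_snd (hh hd)
      exact ⟨i, hd⟩
    · intro d hd
      obtain ⟨i, rfl⟩ := exists_single_of_weight_snd (hh hd)
      exact ⟨_, rfl⟩
    · intro j
      apply hh.coeff_eq_zero
      simp [Finsupp.weight_single, baseDeg]
  obtain ⟨x, ⟨i, hi⟩, hx⟩ := exists_ne_zero_dotProduct_eq_zero hm fun i => u (Sum.inl i)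
  obtain ⟨y, ⟨j, hj⟩, hy⟩ := exists_ne_zero_dotProduct_eq_zero hn fun i => v (Sum.inr i)
  obtain ⟨k, hki, hk⟩ := exists_ne_coeff_ne_zero hu hx hi
  obtain ⟨l, hlj, hl⟩ := exists_ne_coeff_ne_zero hv hy hj
  let p : Base m n → K := Sum.elim (fun k => (x i)⁻¹ * x k) (fun k => (y j)⁻¹ * y k)
  have hpi : p (Sum.inl i) = 1 := by simp [p, hi]
  have hpj : p (Sum.inr j) = 1 := by simp [p, hj]
  have hup : ∑ l, u l * p l = 0 := by
    simp only [Fintype.sum_sum_type, hul, p, Sum.elim_inl, zero_mul, Finset.sum_const_zero,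
      add_zero, mul_left_comm, ← Finset.mul_sum, hx, mul_zero]
  have hvp : ∑ l, v l * p l = 0 := by
    simp only [Fintype.sum_sum_type, hvl, p, Sum.elim_inr, zero_mul, Finset.sum_const_zero,
      zero_add, mul_left_comm, ← Finset.mul_sum, hy, mul_zero]
  have hev : ∀ a : Base m n → K, eval p (linearForm a) = ∑ l, a l * p l := by
    intro a
    simp [linearForm]
  let I : Ideal (MvPolynomial (Base m n) K) := Ideal.span {linearForm u * linearForm v,
      MvPolynomial.X (Sum.inl i) - 1, MvPolynomial.X (Sum.inr j) - 1}
  have hI : ∀ q ∈ I, eval p q = 0 := by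
    have : I ≤ RingHom.ker (eval p) := by
      rw [Ideal.span_le]
      rintro q (rfl | rfl | rfl)
      · simp [RingHom.mem_ker, hev, hup]
      · simp [RingHom.mem_ker, hpi]
      · simp [RingHom.mem_ker, hpj]
    exact fun q hq => this hq
  let P : Ideal (ChartRing (linearForm u * linearForm v) i j) :=
    RingHom.ker (Ideal.Quotient.lift I (eval p) hI)
  have hP : P.IsPrime := RingHom.ker_isPrime _
  have := (hX i j P).1
  have hz : algebraMap _ (Localization.AtPrime P) (Ideal.Quotient.mk I (linearForm u)) *
      algebraMap _ (Localization.AtPrime P) (Ideal.Quotient.mk I (linearForm v)) = 0 := by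
    rw [← map_mul, ← map_mul, Ideal.Quotient.eq_zero_iff_mem.mpr, map_zero]
    exact Ideal.subset_span (by simp)
  have key : ∀ q : MvPolynomial (Base m n) K,
      algebraMap _ (Localization.AtPrime P) (Ideal.Quotient.mk I q) = 0 →
      ∃ s, eval p s ≠ 0 ∧ s * q ∈ I := by
    intro q hq
    obtain ⟨⟨c, hc⟩, hcq⟩ := (IsLocalization.map_eq_zero_iff P.primeCompl _ _).mp hq
    obtain ⟨s, rfl⟩ := Ideal.Quotient.mk_surjective c
    refine ⟨s, fun h => hc ?_, Ideal.Quotient.eq_zero_iff_mem.mp (by rw [map_mul]; exact hcq)⟩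
    exact h
  rcases mul_eq_zero.mp hz with h | h
  · obtain ⟨s, hs, hsI⟩ := key _ h
    exact smul_linearForm_notMem (k := Sum.inl k) hup hvp hpi hpj (by simpa using hki) (by simp)
      hk (hvl k) hs hsI
  · obtain ⟨s, hs, hsI⟩ := key _ h
    refine smul_linearForm_notMem (k := Sum.inr l) hvp hup hpi hpj (by simp) (by simpa using hlj)
      hl (hul l) hs ?_
    rw [mul_comm (linearForm v) (linearForm u)]
    exact hsI

theorem eq_C_of_isWeightedHomogeneous_zero {g : MvPolynomial (Base m n) K}
    (hg : IsWeightedHomogeneous (baseDeg m n) g (0, 0)) : g = C (coeff 0 g) := by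
  classical
  ext u
  rw [coeff_C]
  split_ifs with h
  · rw [h]
  · by_contra hu
    have := degree_eq_of_weight (hg hu)
    rw [add_zero, Finsupp.degree_eq_zero_iff] at this
    exact h this.symm

theorem isUnit_of_isWeightedHomogeneous_zero {g : MvPolynomial (Base m n) K} (hg0 : g ≠ 0)
    (hg : IsWeightedHomogeneous (baseDeg m n) g (0, 0)) : IsUnit g := by
  have h1 := eq_C_of_isWeightedHomogeneous_zero hg
  rw [h1]
  refine (IsUnit.mk0 _ fun h0 => hg0 ?_).map C
  rw [h1, h0, map_zero]

theorem irreducible_of_isNormalHypersurface (hm : 1 ≤ m) (hn : 1 ≤ n)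
    {f : MvPolynomial (Base m n) K} (hf : IsDefining f) (hX : IsNormalHypersurface f) :
    Irreducible f := by
  obtain ⟨hf0, hf⟩ := hf
  refine ⟨fun hu => ?_, fun g h hgh => ?_⟩
  · obtain ⟨c, hc⟩ := MvPolynomial.isUnit_iff_eq_C_of_isReduced.mp hu
    have h1 := hf.inj_right hf0 (m := (1, 1)) (n := 0) (by
      rw [hc.2]; exact isWeightedHomogeneous_C _ _)
    simp at h1
  · subst hgh
    rw [isWeightedHomogeneous_baseDeg] at hf
    obtain ⟨k, l, hkl, hg1, hh1⟩ := isWeightedHomogeneous_factors hf.1 hf0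
    obtain ⟨k', l', hkl', hg2, hh2⟩ := isWeightedHomogeneous_factors hf.2 hf0
    have hg := isWeightedHomogeneous_baseDeg.mpr ⟨hg1, hg2⟩
    have hh := isWeightedHomogeneous_baseDeg.mpr ⟨hh1, hh2⟩
    have hg0 := left_ne_zero_of_mul hf0
    have hh0 := right_ne_zero_of_mul hf0
    obtain ⟨rfl, rfl⟩ | ⟨rfl, rfl⟩ : (k = 0 ∧ l = 1) ∨ (k = 1 ∧ l = 0) := by omega
    all_goals obtain ⟨rfl, rfl⟩ | ⟨rfl, rfl⟩ : (k' = 0 ∧ l' = 1) ∨ (k' = 1 ∧ l' = 0) := by omega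
    · exact Or.inl (isUnit_of_isWeightedHomogeneous_zero hg0 hg)
    · exact absurd (mul_comm g h ▸ hX) (not_isNormalHypersurface_mul hm hn hh hg hh0 hg0)
    · exact absurd hX (not_isNormalHypersurface_mul hm hn hg hh hg0 hh0)
    · exact Or.inr (isUnit_of_isWeightedHomogeneous_zero hh0 hh)

end Irreducible

/-! ### Extending fractions across the locus where one set of variables vanishes -/

section Extension

variable {K σ : Type*} [Field K]

theorem mem_span_X_of_mul_mem {s : Set σ} {f g : MvPolynomial σ K}
    (hf : f ∉ Ideal.span (X '' s : Set (MvPolynomial σ K)))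
    (h : f * g ∈ Ideal.span (X '' s : Set (MvPolynomial σ K))) :
    g ∈ Ideal.span (X '' s : Set (MvPolynomial σ K)) := by
  classical
  let θ : MvPolynomial σ K →ₐ[K] MvPolynomial σ K := aeval fun k => if k ∈ s then 0 else X k
  have h1 : ∀ q ∈ Ideal.span (X '' s : Set (MvPolynomial σ K)), θ q = 0 := by
    have : Ideal.span (X '' s : Set (MvPolynomial σ K)) ≤ RingHom.ker θ := by
      rw [Ideal.span_le]
      intro q hq
      obtain ⟨k, hk, rfl⟩ := hq
      simp [RingHom.mem_ker, θ, hk]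
    exact fun q hq => this hq
  have h2 : ∀ q, θ q = 0 → q ∈ Ideal.span (X '' s : Set (MvPolynomial σ K)) := by
    intro q hq
    have e : (Ideal.Quotient.mkₐ K (Ideal.span (X '' s : Set (MvPolynomial σ K)))).comp θ =
        Ideal.Quotient.mkₐ K _ := by
      ext k
      by_cases hk : k ∈ s
      · simp only [AlgHom.comp_apply, θ, aeval_X, if_pos hk, map_zero]
        exact (Ideal.Quotient.eq_zero_iff_mem.mpr
          (Ideal.subset_span (Set.mem_image_of_mem X hk))).symm
      · simp [θ, hk]
    have := DFunLike.congr_fun e q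
    rw [AlgHom.comp_apply, hq, map_zero] at this
    exact Ideal.Quotient.eq_zero_iff_mem.mp this.symm
  have h3 := h1 _ h
  rw [map_mul] at h3
  exact h2 _ ((mul_eq_zero.mp h3).resolve_left fun h0 => hf (h2 _ h0))

/-- If `v` and `h` are homogeneous, a quotient of `v` by `h` modulo `f` can be replaced by its
component of the expected weight. -/
theorem dvd_sub_weightedHomogeneousComponent_mul {w : σ → ℕ} {f h v q : MvPolynomial σ K}
    {k c e : ℕ} (hf : IsWeightedHomogeneous w f k) (hh : IsWeightedHomogeneous w h c)
    (hv : IsWeightedHomogeneous w v (e + c)) (hdvd : f ∣ v - q * h) :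
    f ∣ v - weightedHomogeneousComponent w e q * h := by
  obtain ⟨r, hr⟩ := hdvd
  have h1 : (weightExpand w v).coeff (e + c) = v := by
    rw [weightExpand_of_isWeightedHomogeneous hv, Polynomial.coeff_C_mul_X_pow, if_pos rfl]
  rw [eq_add_of_sub_eq' hr, mul_comm f, map_add, map_mul, map_mul,
    weightExpand_of_isWeightedHomogeneous hf, weightExpand_of_isWeightedHomogeneous hh,
    Polynomial.coeff_add, ← mul_assoc, ← mul_assoc, Polynomial.coeff_mul_X_pow,
    Polynomial.coeff_mul_C, Polynomial.coeff_mul_X_pow', Polynomial.coeff_mul_C,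
    coeff_weightExpand] at h1
  rw [eq_add_of_sub_eq' hr, mul_comm f, ← h1, add_sub_cancel_left]
  split_ifs
  · exact dvd_mul_left _ _
  · exact dvd_zero _

/-- Every monomial of a form `f` of weight one contains exactly one variable of weight one. So `f`
avoids the ideal of some two of these variables, unless there are only two of them. -/
theorem exists_pair_notMem_span {w : σ → ℕ} (hT : ∃ i j, i ≠ j ∧ w i = 1 ∧ w j = 1)
    {f : MvPolynomial σ K} (hf : IsWeightedHomogeneous w f 1) (hf0 : f ≠ 0) :
    ∃ i j, i ≠ j ∧ w i = 1 ∧ w j = 1 ∧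
      (f ∉ Ideal.span (X '' {i, j} : Set (MvPolynomial σ K)) ∨ ∀ k, w k = 1 → k = i ∨ k = j) := by
  classical
  obtain ⟨i, j, hij, hi, hj⟩ := hT
  by_cases hk : ∀ k, w k = 1 → k = i ∨ k = j
  · exact ⟨i, j, hij, hi, hj, Or.inr hk⟩
  push Not at hk
  obtain ⟨k, hk, hki, hkj⟩ := hk
  obtain ⟨d, hd⟩ := ne_zero_iff.mp hf0
  have hd1 := hf hd
  have two : ∀ a b, a ≠ b → w a = 1 → w b = 1 → d a ≠ 0 → d b ≠ 0 → False := by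
    intro a b hab ha hb hda hdb
    have hle : Finsupp.single a 1 + Finsupp.single b 1 ≤ d := by
      intro l
      simp only [Finsupp.add_apply, Finsupp.single_apply]
      split_ifs with h1 h2 h2
      · exact absurd (h1.trans h2.symm) hab
      · subst h1; omega
      · subst h2; omega
      · omega
    obtain ⟨e, rfl⟩ := exists_add_of_le hle
    simp only [map_add, Finsupp.weight_single, ha, hb, smul_eq_mul] at hd1
    omega
  have out : ∀ a b, a ≠ b → w a = 1 → w b = 1 → d a = 0 → d b = 0 →
      ∃ i j, i ≠ j ∧ w i = 1 ∧ w j = 1 ∧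
      (f ∉ Ideal.span (X '' {i, j} : Set (MvPolynomial σ K)) ∨
        ∀ k, w k = 1 → k = i ∨ k = j) := by
    intro a b hab ha hb hda hdb
    refine ⟨a, b, hab, ha, hb, Or.inl fun hmem => ?_⟩
    obtain ⟨l, hl, hne⟩ := mem_ideal_span_X_image.mp hmem d (mem_support_iff.mpr hd)
    rcases hl with rfl | rfl
    · exact hne hda
    · exact hne hdb
  by_cases hdi : d i = 0
  · by_cases hdj : d j = 0
    · exact out i j hij hi hj hdi hdj
    · exact out i k (Ne.symm hki) hi hk hdi (by_contra fun h => two j k (Ne.symm hkj) hj hk hdj h)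
  · exact out j k (Ne.symm hkj) hj hk (by_contra fun h => two i j hij hi hj hdi h)
      (by_contra fun h => two i k (Ne.symm hki) hi hk hdi h)

/-- If `u F / H`, of nonnegative weight, becomes a polynomial modulo `f` after multiplication by
each variable of weight one, it is a polynomial modulo `f`. The syzygy `X_j P_i - X_i P_j = f G` of
two such multiples `P_i = X_i u F / H` can be lifted from the quotient by `f` to the polynomial
ring, since `G` lies in the ideal of `X_i`, `X_j`: either `f` is a nonzerodivisor modulo that prime
ideal, or there are no other variables of weight one and `G` has positive weight. -/
theorem mul_mem_span_of_forall_X_mul {w : σ → ℕ} (hw : ∀ i, w i ≤ 1)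
    (hT : ∃ i j, i ≠ j ∧ w i = 1 ∧ w j = 1) {f F H u : MvPolynomial σ K} {a c p : ℕ}
    (hprime : Prime f) (hf : IsWeightedHomogeneous w f 1) (hX : ∀ i, ¬ f ∣ X i)
    (hF : IsWeightedHomogeneous w F (a + c)) (hH : IsWeightedHomogeneous w H c)
    (hfH : ¬ f ∣ H) (hu : IsWeightedHomogeneous w u p)
    (h : ∀ i, w i = 1 → X i * u * F ∈ Ideal.span {f, H}) : u * F ∈ Ideal.span {f, H} := by
  obtain ⟨i, j, hij, hi, hj, hcase⟩ := exists_pair_notMem_span hT hf hprime.ne_zero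
  have hP : ∀ k, w k = 1 → ∃ q, IsWeightedHomogeneous w q (1 + p + a) ∧
      f ∣ X k * u * F - q * H := by
    intro k hk
    obtain ⟨r, q, hrq⟩ := Ideal.mem_span_pair.mp (h k hk)
    refine ⟨_, weightedHomogeneousComponent_isWeightedHomogeneous _ q,
      dvd_sub_weightedHomogeneousComponent_mul hf hH ?_ (q := q)
        ⟨r, by linear_combination -hrq⟩⟩
    have h1 := ((isWeightedHomogeneous_X K w k).mul hu).mul hF
    rwa [hk, ← add_assoc] at h1
  obtain ⟨P, hPh, hPd⟩ := hP i hi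
  obtain ⟨Q, hQh, hQd⟩ := hP j hj
  have hsyz : f ∣ X j * P - X i * Q := by
    refine (hprime.dvd_or_dvd (a := X j * P - X i * Q) (b := H) ?_).resolve_right hfH
    have := dvd_sub (hQd.mul_left (X i)) (hPd.mul_left (X j))
    convert this using 1
    ring
  obtain ⟨G, hG⟩ := hsyz
  have hGmem : G ∈ Ideal.span (X '' {i, j} : Set (MvPolynomial σ K)) := by
    rcases hcase with hcase | hcase
    · refine mem_span_X_of_mul_mem hcase ?_
      rw [← hG]
      exact sub_mem (Ideal.mul_mem_right _ _ (Ideal.subset_span ⟨j, by simp, rfl⟩))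
        (Ideal.mul_mem_right _ _ (Ideal.subset_span ⟨i, by simp, rfl⟩))
    · by_cases hG0 : G = 0
      · rw [hG0]; exact zero_mem _
      have hhom : IsWeightedHomogeneous w (f * G) (1 + (1 + p + a)) := by
        rw [← hG]
        refine IsWeightedHomogeneous.sub ?_ ?_
        · have := (isWeightedHomogeneous_X K w j).mul hPh
          rwa [hj] at this
        · have := (isWeightedHomogeneous_X K w i).mul hQh
          rwa [hi] at this
      obtain ⟨k, l, hkl, hfk, hGl⟩ := isWeightedHomogeneous_factors hhom
        (mul_ne_zero hprime.ne_zero hG0)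
      have hk1 := hfk.inj_right hprime.ne_zero hf
      rw [mem_ideal_span_X_image]
      intro d hd
      have hwd := hGl (mem_support_iff.mp hd)
      by_contra! hno
      have h0 : Finsupp.weight w d = 0 := by
        rw [Finsupp.weight_apply, Finsupp.sum]
        refine Finset.sum_eq_zero fun k hk => ?_
        have hk0 : w k = 0 := by
          by_contra hne
          have hk1 : w k = 1 := le_antisymm (hw k) (Nat.one_le_iff_ne_zero.mpr hne)
          have := hno k (by simpa using hcase k hk1)
          exact (Finsupp.mem_support_iff.mp hk) this
        rw [hk0, smul_zero]
      omega
  rw [Set.image_pair, Ideal.mem_span_pair] at hGmem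
  obtain ⟨G₀, G₁, rfl⟩ := hGmem
  have hXij : ¬ (X i : MvPolynomial σ K) ∣ X j := by
    rw [X_dvd_X]
    exact hij
  have hdvd : X i ∣ P - f * G₁ := by
    refine ((X_prime (i := i)).dvd_or_dvd (a := X j) (b := P - f * G₁) ?_).resolve_left hXij
    refine ⟨Q + f * G₀, ?_⟩
    linear_combination hG
  obtain ⟨W, hW⟩ := hdvd
  have hfin : f ∣ u * F - W * H := by
    refine (hprime.dvd_or_dvd (a := X i) (b := u * F - W * H) ?_).resolve_left (hX i)
    obtain ⟨R, hR⟩ := hPd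
    refine ⟨R + G₁ * H, ?_⟩
    linear_combination hR + H * hW
  obtain ⟨R, hR⟩ := hfin
  rw [Ideal.mem_span_pair]
  exact ⟨R, W, by linear_combination -hR⟩

end Extension

/-! ### Sections over the central fibre are polynomials -/

section CentralSections

variable {K : Type*} [Field K] {m n : ℕ}

theorem IsDefining.totalDegree {f : MvPolynomial (Base m n) K} (hf : IsDefining f) :
    f.totalDegree = 2 := by
  have h : f.IsHomogeneous 2 := by
    intro d hd
    have := degree_eq_of_weight (hf.2 hd)
    rwa [Finsupp.degree_eq_weight_one] at this
  exact h.totalDegree hf.1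

theorem IsDefining.not_dvd_X {f : MvPolynomial (Base m n) K} (hf : IsDefining f) (i : Base m n) :
    ¬ f ∣ X i := by
  rintro ⟨g, hg⟩
  have hne : f * g ≠ 0 := hg ▸ X_ne_zero i
  have h1 := congrArg MvPolynomial.totalDegree hg
  rw [totalDegree_X, totalDegree_mul_of_isDomain hf.1 (right_ne_zero_of_mul hne),
    hf.totalDegree] at h1
  omega

/-- The Nullstellensatz for the cone over an irreducible hypersurface. -/
theorem dvd_of_forall_cone_eval_eq_zero [IsAlgClosed K] {f : MvPolynomial (Base m n) K}
    (hf : IsDefining f) (hp : Prime f) {g : MvPolynomial (Base m n) K}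
    (h : ∀ p ∈ cone f, eval p g = 0) : f ∣ g := by
  have hprime : (Ideal.span {f}).IsPrime := (Ideal.span_singleton_prime hf.1).mpr hp
  have hmem : X (Sum.inl 0) * (X (Sum.inr 0) * g) ∈ Ideal.span {f} := by
    rw [← IsPrime.vanishingIdeal_zeroLocus (K := K) (Ideal.span {f}), mem_vanishingIdeal_iff]
    intro p hpz
    have hpf : eval p f = 0 := hpz f (Ideal.mem_span_singleton_self f)
    change eval p _ = 0
    rw [map_mul, map_mul, eval_X, eval_X]
    by_cases h1 : p (Sum.inl 0) = 0
    · rw [h1, zero_mul]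
    by_cases h2 : p (Sum.inr 0) = 0
    · rw [h2, zero_mul, mul_zero]
    rw [h p ⟨⟨0, h1⟩, ⟨0, h2⟩, hpf⟩, mul_zero, mul_zero]
  rw [Ideal.mem_span_singleton] at hmem
  exact (hp.dvd_or_dvd ((hp.dvd_or_dvd hmem).resolve_left (hf.not_dvd_X _))).resolve_left
    (hf.not_dvd_X _)

/-- The point of the central fibre given by a point of the cone. -/
def toCentral {f : MvPolynomial (Base m n) K} (p : cone f) : central f :=
  ⟨Sum.elim p.1 (fun _ => 0), p.2, rfl⟩

theorem toCentral_surjective {f : MvPolynomial (Base m n) K} (z : central f) :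
    ∃ p : cone f, toCentral p = z := by
  refine ⟨⟨fun i => z.1 (Sum.inl i), z.2.1⟩, Subtype.ext ?_⟩
  funext i
  rcases i with i | i
  · rfl
  · rw [Subsingleton.elim i 0]
    exact z.2.2.symm

/-- The defining property of a section over the central fibre, with the affine coordinate set to
zero. -/
theorem exists_quotient_of_mem_sections {f : MvPolynomial (Base m n) K} {a b : ℕ}
    {s : central f → K} (hs : s ∈ sections (central f) a b) (p : cone f) :
    ∃ (c : ℕ × ℕ) (g h : MvPolynomial (Base m n) K),
      IsWeightedHomogeneous (baseDeg m n) g ((a, b) + c) ∧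
      IsWeightedHomogeneous (baseDeg m n) h c ∧ eval p.1 h ≠ 0 ∧
      ∀ p' : cone f, eval p'.1 h ≠ 0 → s (toCentral p') = eval p'.1 g / eval p'.1 h := by
  obtain ⟨c, g, h, hg, hh, hp, e⟩ := hs (toCentral p)
  let φ : Coord m n 1 → MvPolynomial (Base m n) K := Sum.elim X (fun _ => 0)
  have hφ : ∀ i, IsWeightedHomogeneous (baseDeg m n) (φ i) (coordDeg m n 1 i) := by
    rintro (i | i)
    · exact isWeightedHomogeneous_X _ _ _
    · exact isWeightedHomogeneous_zero _ _ _
  have hev : ∀ (p : cone f) (q : MvPolynomial (Coord m n 1) K),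
      eval p.1 (bind₁ φ q) = eval (toCentral p).1 q := by
    intro p q
    rw [← coe_aeval_eq_eval, RingHom.coe_coe, aeval_bind₁, ← coe_aeval_eq_eval, RingHom.coe_coe]
    congr 2
    funext i
    rcases i with i | i <;> simp [φ, toCentral]
  refine ⟨c, bind₁ φ g, bind₁ φ h, isWeightedHomogeneous_bind hφ hg,
    isWeightedHomogeneous_bind hφ hh, by rwa [hev], fun p' hp' => ?_⟩
  rw [hev] at hp'
  rw [hev, hev]
  exact e _ hp'

/-- Restriction of polynomials to the central fibre. -/
noncomputable def restrict (f : MvPolynomial (Base m n) K) :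
    MvPolynomial (Base m n) K →ₗ[K] (central f → K) where
  toFun g z := eval (fun i => z.1 (Sum.inl i)) g
  map_add' g h := by funext z; simp
  map_smul' r g := by funext z; simp [smul_eval]

theorem restrict_mem_sections {f g : MvPolynomial (Base m n) K} {a b : ℕ}
    (hg : IsWeightedHomogeneous (baseDeg m n) g (a, b)) :
    restrict f g ∈ sections (central f) a b := by
  intro z
  refine ⟨0, rename Sum.inl g, 1, ?_, isWeightedHomogeneous_one _ _, by simp, fun z' _ => ?_⟩
  · rw [rename_eq_aeval, add_zero]
    exact isWeightedHomogeneous_bind (fun i => isWeightedHomogeneous_X _ _ _) hg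
  · simp [restrict, eval_rename, Function.comp_def]

theorem restrict_eq_zero_iff [IsAlgClosed K] {f : MvPolynomial (Base m n) K}
    (hf : IsDefining f) (hp : Prime f) {g : MvPolynomial (Base m n) K} :
    restrict f g = 0 ↔ f ∣ g := by
  refine ⟨fun h => dvd_of_forall_cone_eval_eq_zero hf hp fun p hpc => ?_, ?_⟩
  · exact congrFun h (toCentral ⟨p, hpc⟩)
  · rintro ⟨q, rfl⟩
    funext z
    simp [restrict, z.2.1.2.2]

theorem X_mul_X_mem_radical [IsAlgClosed K] {f : MvPolynomial (Base m n) K}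
    {J : Ideal (MvPolynomial (Base m n) K)} (hfJ : f ∈ J)
    (hJ : ∀ p ∈ cone f, ∃ h ∈ J, eval p h ≠ 0) (i : Fin (m + 1)) (j : Fin (n + 1)) :
    X (Sum.inl i) * X (Sum.inr j) ∈ J.radical := by
  rw [← vanishingIdeal_zeroLocus_eq_radical (K := K), mem_vanishingIdeal_iff]
  intro p hp
  by_contra hne
  simp only [map_mul, aeval_X, mul_eq_zero, not_or] at hne
  obtain ⟨h, hh, hhp⟩ := hJ p ⟨⟨i, hne.1⟩, ⟨j, hne.2⟩, hp f hfJ⟩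
  exact hhp (hp h hh)

/-- `H^0(X, O(a, b))` consists of restrictions of bihomogeneous polynomials. -/
theorem exists_restrict_eq [IsAlgClosed K] (hm : 1 ≤ m) (hn : 1 ≤ n)
    {f : MvPolynomial (Base m n) K} (hf : IsDefining f) (hp : Prime f) {a b : ℕ}
    {s : central f → K} (hs : s ∈ sections (central f) a b) :
    ∃ g, IsWeightedHomogeneous (baseDeg m n) g (a, b) ∧ restrict f g = s := by
  classical
  have hcone : ∃ p, p ∈ cone f := by
    by_contra! h
    exact hp.not_isUnit (isUnit_of_dvd_one (dvd_of_forall_cone_eval_eq_zero hf hp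
      fun p hpc => absurd hpc (h p)))
  obtain ⟨p₀, hp₀⟩ := hcone
  obtain ⟨c, F, H, hF, hH, hH0, hs₀⟩ := exists_quotient_of_mem_sections hs ⟨p₀, hp₀⟩
  have hndvd : ∀ {h : MvPolynomial (Base m n) K} {p}, p ∈ cone f → eval p h ≠ 0 → ¬ f ∣ h := by
    rintro h p hpc hne ⟨q, rfl⟩
    exact hne (by rw [map_mul, hpc.2.2, zero_mul])
  have hfH := hndvd hp₀ hH0
  -- Two local expressions of `s` as a quotient agree modulo `f`.
  have hglue : ∀ {g h : MvPolynomial (Base m n) K}, ¬ f ∣ h →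
      (∀ p' : cone f, eval p'.1 h ≠ 0 → s (toCentral p') = eval p'.1 g / eval p'.1 h) →
      f ∣ h * F - g * H := by
    intro g h hh hsh
    have := dvd_of_forall_cone_eval_eq_zero (g := h * (H * (h * F - g * H))) hf hp ?_
    · exact (hp.dvd_or_dvd ((hp.dvd_or_dvd this).resolve_left hh)).resolve_left hfH
    · intro p hpc
      simp only [map_mul, map_sub]
      by_cases h1 : eval p h = 0
      · rw [h1, zero_mul]
      by_cases h2 : eval p H = 0
      · rw [h2, zero_mul, mul_zero]
      have e := (hsh ⟨p, hpc⟩ h1).symm.trans (hs₀ ⟨p, hpc⟩ h2)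
      rw [div_eq_div_iff h1 h2] at e
      rw [e]
      ring
  -- `J` is the ideal of the denominators of `s`: all `u` such that `u s` is a polynomial.
  let J : Ideal (MvPolynomial (Base m n) K) := (Ideal.span {f, H}).colon {F}
  have hJ : ∀ u, u ∈ J ↔ u * F ∈ Ideal.span {f, H} := by
    intro u
    simp [J, Submodule.mem_colon_singleton]
  have hJp : ∀ p ∈ cone f, ∃ h ∈ J, eval p h ≠ 0 := by
    intro p hpc
    obtain ⟨c', g, h, -, -, hne, hsh⟩ := exists_quotient_of_mem_sections hs ⟨p, hpc⟩
    refine ⟨h, ?_, hne⟩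
    obtain ⟨q, hq⟩ := hglue (hndvd hpc hne) hsh
    rw [hJ, Ideal.mem_span_pair]
    exact ⟨q, g, by linear_combination -hq⟩
  have hrad := X_mul_X_mem_radical ((hJ f).mpr (Ideal.mul_mem_right _ _
    (Ideal.subset_span (by simp)))) hJp
  let A : Ideal (MvPolynomial (Base m n) K) := Ideal.span (Set.range fun i => X (Sum.inl i))
  let B : Ideal (MvPolynomial (Base m n) K) := Ideal.span (Set.range fun i => X (Sum.inr i))
  obtain ⟨N, hN⟩ : ∃ N, (A * B) ^ N ≤ J := by
    refine Ideal.exists_pow_le_of_le_radical_of_fg ?_ (IsNoetherian.noetherian _)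
    rw [Ideal.span_mul_span, Ideal.span_le]
    rintro _ ⟨_, ⟨i, rfl⟩, _, ⟨j, rfl⟩, rfl⟩
    exact hrad i j
  have htop : ∀ u : Base m n →₀ ℕ, Finsupp.weight (baseDeg m n) u = (N, N) →
      monomial u 1 ∈ J := by
    intro u hu
    rw [weight_eq_iff] at hu
    apply hN
    rw [mul_pow, monomial_eq, C_1, one_mul, Finsupp.prod_fintype _ _ (by simp),
      Fintype.prod_sum_type]
    refine Ideal.mul_mem_mul ?_ ?_
    · rw [← hu.1, ← Finset.prod_pow_eq_pow_sum]
      exact Ideal.prod_mem_prod fun i _ =>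
        Ideal.pow_mem_pow (Ideal.subset_span (Set.mem_range_self i)) _
    · rw [← hu.2, ← Finset.prod_pow_eq_pow_sum]
      exact Ideal.prod_mem_prod fun i _ =>
        Ideal.pow_mem_pow (Ideal.subset_span (Set.mem_range_self i)) _
  obtain ⟨c₁, c₂⟩ := c
  rw [Prod.mk_add_mk, isWeightedHomogeneous_baseDeg] at hF
  rw [isWeightedHomogeneous_baseDeg] at hH
  have hf' := isWeightedHomogeneous_baseDeg.mp hf.2
  have hX : ∀ (i : Base m n) (u : Base m n →₀ ℕ),
      (X i : MvPolynomial (Base m n) K) * monomial u 1 = monomial (Finsupp.single i 1 + u) 1 := by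
    intro i u
    rw [X, monomial_mul, one_mul]
  have hleft : ∀ p q, (∀ u : Base m n →₀ ℕ, Finsupp.weight (baseDeg m n) u = (p, q) →
      monomial u 1 ∈ J) → ∀ u : Base m n →₀ ℕ, Finsupp.weight (baseDeg m n) u = (0, q) →
      monomial u 1 ∈ J := by
    intro p q
    induction p with
    | zero => exact id
    | succ p ih =>
      refine fun h => ih fun u hu => ?_
      rw [hJ]
      refine mul_mem_span_of_forall_X_mul (w := fun i => (baseDeg m n i).1) ?_ ?_ hp hf'.1
        hf.not_dvd_X hF.1 hH.1 hfH (isWeightedHomogeneous_monomial _ u 1 rfl) ?_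
      · rintro (i | i) <;> simp [baseDeg]
      · exact ⟨Sum.inl 0, Sum.inl ⟨1, by omega⟩, by simp [Fin.ext_iff], rfl, rfl⟩
      · intro i hi
        rw [hX, ← hJ]
        apply h
        rcases i with i | i
        · rw [map_add, hu, Finsupp.weight_single]
          simp [baseDeg, add_comm]
        · simp [baseDeg] at hi
  have hright : ∀ p q, (∀ u : Base m n →₀ ℕ, Finsupp.weight (baseDeg m n) u = (p, q) →
      monomial u 1 ∈ J) → ∀ u : Base m n →₀ ℕ, Finsupp.weight (baseDeg m n) u = (p, 0) →
      monomial u 1 ∈ J := by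
    intro p q
    induction q with
    | zero => exact id
    | succ q ih =>
      refine fun h => ih fun u hu => ?_
      rw [hJ]
      refine mul_mem_span_of_forall_X_mul (w := fun i => (baseDeg m n i).2) ?_ ?_ hp hf'.2
        hf.not_dvd_X hF.2 hH.2 hfH (isWeightedHomogeneous_monomial _ u 1 rfl) ?_
      · rintro (i | i) <;> simp [baseDeg]
      · exact ⟨Sum.inr 0, Sum.inr ⟨1, by omega⟩, by simp [Fin.ext_iff], rfl, rfl⟩
      · intro i hi
        rw [hX, ← hJ]
        apply h
        rcases i with i | i
        · simp [baseDeg] at hi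
        · rw [map_add, hu, Finsupp.weight_single]
          simp [baseDeg, add_comm]
  -- From the monomials of bidegree `(N, N)` down to those of bidegree `(0, N)` and `(0, 0)`.
  have hone : F ∈ Ideal.span {f, H} := by
    have := (hJ _).mp (hright 0 N (hleft N N htop) 0 (by simp; rfl))
    rwa [monomial_zero', C_1, one_mul] at this
  obtain ⟨G, hG, hfG⟩ : ∃ G, IsWeightedHomogeneous (baseDeg m n) G (a, b) ∧ f ∣ F - G * H := by
    obtain ⟨r, q, hrq⟩ := Ideal.mem_span_pair.mp hone
    refine ⟨weightedHomogeneousComponent (fun i => (baseDeg m n i).2) b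
      (weightedHomogeneousComponent (fun i => (baseDeg m n i).1) a q), ?_,
      dvd_sub_weightedHomogeneousComponent_mul hf'.2 hH.2 hF.2
        (dvd_sub_weightedHomogeneousComponent_mul hf'.1 hH.1 hF.1 (q := q)
          ⟨r, by linear_combination -hrq⟩)⟩
    refine isWeightedHomogeneous_baseDeg.mpr ⟨fun d hd => ?_,
      weightedHomogeneousComponent_isWeightedHomogeneous _ _⟩
    refine weightedHomogeneousComponent_isWeightedHomogeneous a q fun h0 => hd ?_
    rw [coeff_weightedHomogeneousComponent, h0, ite_self]
  refine ⟨G, hG, ?_⟩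
  funext z
  obtain ⟨p, rfl⟩ := toCentral_surjective z
  obtain ⟨c', g, h, -, -, hne, hsh⟩ := exists_quotient_of_mem_sections hs p
  have h1 := hglue (hndvd p.2 hne) hsh
  have h2 : f ∣ h * G - g := by
    refine (hp.dvd_or_dvd (a := h * G - g) (b := H) ?_).resolve_right hfH
    convert dvd_sub h1 (hfG.mul_left h) using 1
    ring
  obtain ⟨q, hq⟩ := h2
  have h3 := congrArg (eval p.1) hq
  rw [map_mul, p.2.2.2, zero_mul, map_sub, map_mul, sub_eq_zero] at h3
  rw [hsh p hne, eq_div_iff hne, ← h3, mul_comm]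
  rfl

end CentralSections

/-! ### Characters of the multiplicative group -/

section Characters

variable {K : Type*} [Field K]

/-- The character `t ↦ t ^ k` of `G_m`, with values in `K`. -/
def zpowChar (K : Type*) [Field K] (k : ℤ) : Kˣ →* K := (Units.coeHom K).comp (zpowGroupHom k)

theorem zpowChar_apply (k : ℤ) (t : Kˣ) : zpowChar K k t = ((t ^ k : Kˣ) : K) := rfl

/-- In characteristic zero, the weight of an eigenvector of `G_m` is determined by the action of the
single element `t = 2`. -/
theorem two_zpow_injective [CharZero K] {a b : ℤ} (h : (2 : K) ^ a = 2 ^ b) : a = b := by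
  have h1 : (2 : ℚ) ^ a = 2 ^ b := by
    have : ((2 : ℚ) ^ a : ℚ) = (((2 : ℚ) ^ b : ℚ) : K) := by
      push_cast
      exact h
    exact_mod_cast this
  exact zpow_right_injective₀ (by norm_num) (by norm_num) h1

theorem prod_zpow_eq_zpow_sum {G ι : Type*} [CommGroup G] (s : Finset ι) (t : G) (k : ι → ℤ) :
    ∏ i ∈ s, t ^ k i = t ^ ∑ i ∈ s, k i := by
  induction s using Finset.cons_induction with
  | empty => simp
  | cons i s hi ih => rw [Finset.prod_cons, Finset.sum_cons, zpow_add, ih]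

theorem zpowChar_injective [CharZero K] : Function.Injective (zpowChar K) := by
  intro a b h
  have := DFunLike.congr_fun h (Units.mk0 2 two_ne_zero)
  simp only [zpowChar_apply, Units.val_zpow_eq_zpow_val, Units.val_mk0] at this
  exact two_zpow_injective this

theorem eq_of_forall_sum_zpow [CharZero K] {s : Finset ℤ} {a b : ℤ → K}
    (h : ∀ t : Kˣ, ∑ k ∈ s, a k * ((t ^ k : Kˣ) : K) = ∑ k ∈ s, b k * ((t ^ k : Kˣ) : K)) :
    ∀ k ∈ s, a k = b k := by
  intro k hk
  have hli := (linearIndependent_monoidHom Kˣ K).comp _ (zpowChar_injective (K := K))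
  refine sub_eq_zero.mp (linearIndependent_iff'.mp hli s (fun k => a k - b k) ?_ k hk)
  funext t
  simp only [Finset.sum_apply, Pi.smul_apply, Function.comp_apply, zpowChar_apply, smul_eq_mul,
    sub_mul, Finset.sum_sub_distrib, h t, sub_self, Pi.zero_apply]

/-- A character of `G_m` that is a rational function on a nonempty open set is a power. -/
theorem exists_eq_zpow_of_rational [CharZero K] (χ : Kˣ →* K) {g h : Polynomial K} (hh : h ≠ 0)
    (hχ : ∀ t : Kˣ, h.eval (t : K) ≠ 0 → χ t = g.eval (t : K) / h.eval (t : K)) :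
    ∃ γ : ℤ, ∀ t : Kˣ, χ t = ((t ^ γ : Kˣ) : K) := by
  by_contra! hno
  -- The characters `χ t ^ i` and `t ^ j` would be distinct, and `h ^ 2 χ = g h` a linear
  -- relation between them.
  let Φ : ℕ ⊕ ℕ → (Kˣ →* K) := Sum.elim (fun i => χ * zpowChar K i) (fun j => zpowChar K j)
  have hχ0 : ∀ t : Kˣ, χ t ≠ 0 := fun t => ((Group.isUnit t).map χ).ne_zero
  have hΦ : Function.Injective Φ := by
    have hlr : ∀ i j : ℕ, χ * zpowChar K i ≠ zpowChar K j := by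
      intro i j e
      obtain ⟨t, ht⟩ := hno (j - i)
      apply ht
      have e1 := DFunLike.congr_fun e t
      rw [MonoidHom.mul_apply, zpowChar_apply, zpowChar_apply] at e1
      rw [zpow_sub, Units.val_mul, ← e1]
      simp
    rintro (i | i) (j | j) e
    · have e1 := DFunLike.congr_fun e (Units.mk0 2 two_ne_zero)
      simp only [Φ, Sum.elim_inl, MonoidHom.mul_apply] at e1
      have e2 := mul_left_cancel₀ (hχ0 _) e1
      simp only [zpowChar_apply, Units.val_zpow_eq_zpow_val, Units.val_mk0] at e2
      exact congrArg Sum.inl (by exact_mod_cast two_zpow_injective e2)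
    · exact absurd e (hlr i j)
    · exact absurd e.symm (hlr j i)
    · exact congrArg Sum.inr (by exact_mod_cast zpowChar_injective e)
  have hli := (linearIndependent_monoidHom Kˣ K).comp _ hΦ
  let c : ℕ ⊕ ℕ → K := Sum.elim (fun i => (h ^ 2).coeff i) (fun j => -(g * h).coeff j)
  let s : Finset (ℕ ⊕ ℕ) :=
    (Finset.range ((h ^ 2).natDegree + 1)).disjSum (Finset.range ((g * h).natDegree + 1))
  have hsum : ∑ i ∈ s, c i • (⇑(Φ i) : Kˣ → K) = 0 := by
    funext t
    have key : (h ^ 2).eval (t : K) * χ t = (g * h).eval (t : K) := by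
      rw [Polynomial.eval_pow, Polynomial.eval_mul]
      by_cases h0 : h.eval (t : K) = 0
      · rw [h0]; ring
      · rw [hχ t h0]; field_simp
    rw [Polynomial.eval_eq_sum_range, Polynomial.eval_eq_sum_range, Finset.sum_mul] at key
    simp only [s, Finset.sum_disjSum, c, Φ, Sum.elim_inl, Sum.elim_inr,
      Finset.sum_apply, Pi.smul_apply, MonoidHom.mul_apply, zpowChar_apply, smul_eq_mul, neg_mul,
      Finset.sum_neg_distrib, zpow_natCast, Units.val_pow_eq_pow_val, Pi.zero_apply]
    rw [← key, add_neg_eq_zero]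
    exact Finset.sum_congr rfl fun i _ => by ring
  have h2 : h ^ 2 ≠ 0 := pow_ne_zero 2 hh
  have := linearIndependent_iff'.mp hli s c hsum (Sum.inl (h ^ 2).natDegree) (by simp [s])
  exact h2 (Polynomial.leadingCoeff_eq_zero.mp this)

end Characters

/-! ### Diagonalization of one-parameter subgroups -/

section Diagonalization

variable {K : Type*} [Field K]

theorem exists_eval₂_eq_sum (g : LaurentPolynomial K) :
    ∃ c : ℤ →₀ K, ∀ t : Kˣ, LaurentPolynomial.eval₂ (RingHom.id K) t g =
      c.sum fun k r => r * ((t ^ k : Kˣ) : K) := by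
  classical
  induction g using LaurentPolynomial.induction_on' with
  | add p q hp hq =>
    obtain ⟨c, hc⟩ := hp
    obtain ⟨c', hc'⟩ := hq
    refine ⟨c + c', fun t => ?_⟩
    rw [map_add, hc, hc', Finsupp.sum_add_index' (by simp) (by intros; ring)]
  | C_mul_T k a =>
    refine ⟨Finsupp.single k a, fun t => ?_⟩
    rw [LaurentPolynomial.eval₂_C_mul_T, Finsupp.sum_single_index (by simp)]
    rfl

/-- A one-parameter subgroup of `SL` is diagonal in suitable coordinates, the rows of `P`, and the
weights add up to zero: the matrix coefficients of `t ^ k` in `φ` are idempotents onto the weight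
spaces. -/
theorem exists_diagonalization [CharZero K] {N : ℕ}
    (φ : Kˣ →* Matrix.SpecialLinearGroup (Fin N) K)
    (halg : ∀ i j, ∃ g : LaurentPolynomial K, ∀ t : Kˣ,
      (φ t).1 i j = LaurentPolynomial.eval₂ (RingHom.id K) t g) :
    ∃ (P Q : Matrix (Fin N) (Fin N) K) (μ : Fin N → ℤ), P * Q = 1 ∧ Q * P = 1 ∧
      (∀ t, P * (φ t).1 = Matrix.diagonal (fun i => ((t ^ μ i : Kˣ) : K)) * P) ∧
      ∑ i, μ i = 0 := by
  classical
  have h1 : ∀ i j, ∃ c : ℤ →₀ K, ∀ t : Kˣ, (φ t).1 i j =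
      c.sum fun k r => r * ((t ^ k : Kˣ) : K) := by
    intro i j
    obtain ⟨g, hg⟩ := halg i j
    obtain ⟨c, hc⟩ := exists_eval₂_eq_sum g
    exact ⟨c, fun t => (hg t).trans (hc t)⟩
  choose c hc using h1
  let S : Finset ℤ := Finset.univ.biUnion fun i => Finset.univ.biUnion fun j => (c i j).support
  let A : ℤ → Matrix (Fin N) (Fin N) K := fun k => Matrix.of fun i j => c i j k
  have hφ : ∀ t i j, (φ t).1 i j = ∑ k ∈ S, A k i j * ((t ^ k : Kˣ) : K) := by
    intro t i j
    rw [hc, Finsupp.sum]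
    refine Finset.sum_subset ?_ ?_
    · intro k hk
      simp only [S, Finset.mem_biUnion, Finset.mem_univ, true_and]
      exact ⟨i, j, hk⟩
    · intro k _ hk
      rw [Finsupp.notMem_support_iff.mp hk, zero_mul]
  have hA : ∀ t, ∀ k ∈ S, (φ t).1 * A k = ((t ^ k : Kˣ) : K) • A k := by
    intro t k hk
    ext i j
    refine eq_of_forall_sum_zpow (s := S) (a := fun k => ((φ t).1 * A k) i j)
      (b := fun k => (((t ^ k : Kˣ) : K) • A k) i j) (fun s => ?_) k hk
    have e1 : (φ (t * s)).1 i j = ∑ l, (φ t).1 i l * (φ s).1 l j := by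
      rw [map_mul]
      rfl
    rw [hφ] at e1
    simp only [Matrix.mul_apply, Matrix.smul_apply, smul_eq_mul, Finset.sum_mul]
    rw [Finset.sum_comm]
    simp only [hφ s, Finset.mul_sum] at e1
    calc _ = ∑ l, ∑ k ∈ S, (φ t).1 i l * (A k l j * ((s ^ k : Kˣ) : K)) := by
          refine Finset.sum_congr rfl fun l _ => Finset.sum_congr rfl fun k _ => ?_
          ring
      _ = _ := by
          rw [← e1]
          refine Finset.sum_congr rfl fun k _ => ?_
          rw [mul_zpow, Units.val_mul]
          ring
  have hone : ∑ k ∈ S, A k = 1 := by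
    ext i j
    have := hφ 1 i j
    simp only [one_zpow, Units.val_one, mul_one] at this
    rw [Matrix.sum_apply, ← this, map_one]
    rfl
  let W : Set (Fin N → K) := {v | ∃ k : ℤ, ∀ t, (φ t).1 *ᵥ v = ((t ^ k : Kˣ) : K) • v}
  have hW : ⊤ ≤ Submodule.span K W := by
    intro v _
    have hv : v = ∑ k ∈ S, A k *ᵥ v := by
      rw [← Matrix.sum_mulVec, hone, Matrix.one_mulVec]
    rw [hv]
    refine Submodule.sum_mem _ fun k hk => Submodule.subset_span ⟨k, fun t => ?_⟩
    rw [Matrix.mulVec_mulVec, hA t k hk, Matrix.smul_mulVec]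
  let b₀ := Module.Basis.ofSpan hW
  let b : Module.Basis (Fin N) K (Fin N → K) :=
    b₀.reindex (b₀.indexEquiv (Pi.basisFun K (Fin N)))
  have hb : ∀ i, ∃ k : ℤ, ∀ t, (φ t).1 *ᵥ b i = ((t ^ k : Kˣ) : K) • b i := by
    intro i
    refine Module.Basis.ofSpan_subset hW ?_
    simp only [b, Module.Basis.reindex_apply]
    exact Set.mem_range_self _
  choose μ hμ using hb
  let e := Pi.basisFun K (Fin N)
  have hPQ : b.toMatrix e * e.toMatrix b = 1 := Module.Basis.toMatrix_mul_toMatrix_flip _ _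
  have hQP : e.toMatrix b * b.toMatrix e = 1 := Module.Basis.toMatrix_mul_toMatrix_flip _ _
  have hdiag : ∀ t, b.toMatrix e * (φ t).1 =
      Matrix.diagonal (fun i => ((t ^ μ i : Kˣ) : K)) * b.toMatrix e := by
    intro t
    have h2 : (φ t).1 * e.toMatrix b =
        e.toMatrix b * Matrix.diagonal (fun i => ((t ^ μ i : Kˣ) : K)) := by
      ext i j
      rw [Matrix.mul_diagonal]
      have := congrFun (hμ j t) i
      simp only [Matrix.mulVec, dotProduct, Pi.smul_apply, smul_eq_mul] at this
      simp only [Matrix.mul_apply, Module.Basis.toMatrix_apply, e, Pi.basisFun_repr]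
      rw [this, mul_comm]
    calc _ = b.toMatrix e * ((φ t).1 * (e.toMatrix b * b.toMatrix e)) := by
          rw [hQP, Matrix.mul_one]
      _ = b.toMatrix e * (((φ t).1 * e.toMatrix b) * b.toMatrix e) := by
          rw [Matrix.mul_assoc (φ t).1]
      _ = (b.toMatrix e * e.toMatrix b) *
          (Matrix.diagonal (fun i => ((t ^ μ i : Kˣ) : K)) * b.toMatrix e) := by
          rw [h2]
          simp only [Matrix.mul_assoc]
      _ = _ := by rw [hPQ, Matrix.one_mul]
  refine ⟨_, _, μ, hPQ, hQP, hdiag, ?_⟩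
  have hdet := congrArg Matrix.det (hdiag (Units.mk0 2 two_ne_zero))
  have hP : (b.toMatrix e).det ≠ 0 := by
    intro h0
    have := congrArg Matrix.det hPQ
    rw [Matrix.det_mul, h0, zero_mul, Matrix.det_one] at this
    exact zero_ne_one this
  rw [Matrix.det_mul, Matrix.det_mul, (φ _).2, Matrix.det_diagonal, mul_one] at hdet
  have h3 := mul_right_cancel₀ hP ((one_mul _).trans hdet)
  refine (two_zpow_injective (K := K) ?_).symm
  rw [zpow_zero, h3]
  rw [← Units.coe_prod, prod_zpow_eq_zpow_sum, Units.val_zpow_eq_zpow_val, Units.val_mk0]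

end Diagonalization

/-! ### The total weight from an eigenbasis -/

section TotalWeight

variable {K M ι : Type*} [Field K] [AddCommGroup M] [Module K M] [Fintype ι]

theorem weightSpace_eq_span [CharZero K] {ρ : Representation K Kˣ M} (b : Module.Basis ι K M)
    {w : ι → ℤ} (h : ∀ t i, ρ t (b i) = ((t ^ w i : Kˣ) : K) • b i) (μ : ℤ) :
    weightSpace ρ μ = Submodule.span K (Set.range fun i : {i // w i = μ} => b i) := by
  apply le_antisymm
  · intro v hv
    have h1 := hv (Units.mk0 2 two_ne_zero)
    have h2 : ∀ i, b.repr v i ≠ 0 → w i = μ := by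
      intro i hi
      have h3 := congrArg (fun u => b.repr u i) h1
      conv_lhs at h3 => rw [← b.sum_repr v]
      simp only [map_sum, map_smul, h, Finsupp.coe_finsetSum, Finset.sum_apply,
        Finsupp.smul_apply, Module.Basis.repr_self, smul_eq_mul] at h3
      classical
      rw [Finset.sum_eq_single i (fun j _ hj => by simp [hj]) (by simp),
        Finsupp.single_eq_same, mul_one, mul_comm] at h3
      have h4 := mul_right_cancel₀ hi h3
      simp only [Units.val_zpow_eq_zpow_val, Units.val_mk0] at h4
      exact two_zpow_injective h4
    rw [← b.sum_repr v]
    refine Submodule.sum_mem _ fun i _ => ?_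
    by_cases hi : b.repr v i = 0
    · rw [hi, zero_smul]
      exact zero_mem _
    · exact Submodule.smul_mem _ _ (Submodule.subset_span ⟨⟨i, h2 i hi⟩, rfl⟩)
  · rw [Submodule.span_le]
    rintro _ ⟨⟨i, rfl⟩, rfl⟩ t
    exact h t i

theorem totalWeight_eq_sum [CharZero K] {ρ : Representation K Kˣ M} (b : Module.Basis ι K M)
    {w : ι → ℤ} (h : ∀ t i, ρ t (b i) = ((t ^ w i : Kˣ) : K) • b i) :
    totalWeight ρ = ∑ i, w i := by
  classical
  have hrank : ∀ μ, Module.finrank K (weightSpace ρ μ) =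
      (Finset.univ.filter fun i => w i = μ).card := by
    intro μ
    rw [weightSpace_eq_span b h, ← Fintype.card_subtype]
    exact finrank_span_eq_card (b.linearIndependent.comp _ Subtype.val_injective)
  rw [totalWeight, finsum_eq_sum_of_support_subset (s := Finset.univ.image w),
    Finset.sum_comp (fun μ => μ) w]
  · refine Finset.sum_congr rfl fun μ _ => ?_
    rw [hrank, nsmul_eq_mul, mul_comm]
  · intro μ hμ
    rw [Function.mem_support, hrank] at hμ
    have h1 := right_ne_zero_of_mul hμ
    rw [Nat.cast_ne_zero, Finset.card_ne_zero] at h1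
    obtain ⟨i, hi⟩ := h1
    simpa using ⟨i, by simpa using hi⟩

end TotalWeight

/-! ### Linear changes of coordinates -/

section CoordChange

variable {K : Type*} [Field K] {m n : ℕ}

/-- Substitution of the linear forms given by the rows of `A` for the `x_i` and of those given by
the rows of `B` for the `y_j`. -/
noncomputable def coordChange (A : Matrix (Fin (m + 1)) (Fin (m + 1)) K)
    (B : Matrix (Fin (n + 1)) (Fin (n + 1)) K) :
    MvPolynomial (Base m n) K →ₐ[K] MvPolynomial (Base m n) K :=
  bind₁ (Sum.elim (fun i => ∑ k, C (A i k) * X (Sum.inl k))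
    (fun j => ∑ k, C (B j k) * X (Sum.inr k)))

theorem isWeightedHomogeneous_coordChange (A : Matrix (Fin (m + 1)) (Fin (m + 1)) K)
    (B : Matrix (Fin (n + 1)) (Fin (n + 1)) K) {g : MvPolynomial (Base m n) K} {c : ℕ × ℕ}
    (hg : IsWeightedHomogeneous (baseDeg m n) g c) :
    IsWeightedHomogeneous (baseDeg m n) (coordChange A B g) c := by
  refine isWeightedHomogeneous_bind ?_ hg
  rintro (i | i)
  · exact IsWeightedHomogeneous.sum Finset.univ (fun k => C (A i k) * X (Sum.inl k)) (1, 0)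
      fun k _ => (isWeightedHomogeneous_X K (baseDeg m n) (Sum.inl k)).C_mul _
  · exact IsWeightedHomogeneous.sum Finset.univ (fun k => C (B i k) * X (Sum.inr k)) (0, 1)
      fun k _ => (isWeightedHomogeneous_X K (baseDeg m n) (Sum.inr k)).C_mul _

theorem eval_coordChange (A : Matrix (Fin (m + 1)) (Fin (m + 1)) K)
    (B : Matrix (Fin (n + 1)) (Fin (n + 1)) K) (p : Base m n → K)
    (g : MvPolynomial (Base m n) K) :
    eval p (coordChange A B g) = eval (Sum.elim (A *ᵥ fun i => p (Sum.inl i))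
      (B *ᵥ fun j => p (Sum.inr j))) g := by
  rw [coordChange, ← coe_aeval_eq_eval, RingHom.coe_coe, aeval_bind₁, ← coe_aeval_eq_eval,
    RingHom.coe_coe]
  congr 2
  funext i
  rcases i with i | i <;> simp [Matrix.mulVec, dotProduct]

theorem coordChange_coordChange {A A' : Matrix (Fin (m + 1)) (Fin (m + 1)) K}
    {B B' : Matrix (Fin (n + 1)) (Fin (n + 1)) K} (hA : A' * A = 1) (hB : B' * B = 1)
    (g : MvPolynomial (Base m n) K) : coordChange A B (coordChange A' B' g) = g := by
  have h : (coordChange A B).comp (coordChange A' B') = AlgHom.id K _ := by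
    ext i : 1
    rcases i with i | i
    · simp only [coordChange, AlgHom.comp_apply, bind₁_X_right, Sum.elim_inl, map_sum, map_mul,
        algHom_C, algebraMap_eq, Finset.mul_sum, AlgHom.id_apply, ← mul_assoc]
      rw [Finset.sum_comm]
      have e : ∀ l, ∑ k, C (A' i k) * C (A k l) * X (Sum.inl l) =
          C ((A' * A) i l) * (X (Sum.inl l) : MvPolynomial (Base m n) K) := fun l => by
        simp only [Matrix.mul_apply, map_sum, Finset.sum_mul, map_mul]
      simp only [e, hA, Matrix.one_apply]
      simp
    · simp only [coordChange, AlgHom.comp_apply, bind₁_X_right, Sum.elim_inr, map_sum, map_mul,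
        algHom_C, algebraMap_eq, Finset.mul_sum, AlgHom.id_apply, ← mul_assoc]
      rw [Finset.sum_comm]
      have e : ∀ l, ∑ k, C (B' i k) * C (B k l) * X (Sum.inr l) =
          C ((B' * B) i l) * (X (Sum.inr l) : MvPolynomial (Base m n) K) := fun l => by
        simp only [Matrix.mul_apply, map_sum, Finset.sum_mul, map_mul]
      simp only [e, hB, Matrix.one_apply]
      simp
  exact DFunLike.congr_fun h g

end CoordChange

/-! ### Monomials of a given bidegree -/

section Monomials

variable {m n : ℕ}

/-- The exponents of the monomials of bidegree `(a, b)`. -/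
noncomputable def exponents (m n a b : ℕ) : Finset (Base m n →₀ ℕ) :=
  (Finset.univ.finsuppAntidiag a ×ˢ Finset.univ.finsuppAntidiag b).map
    Finsupp.sumFinsuppEquivProdFinsupp.symm.toEmbedding

theorem mem_exponents {a b : ℕ} {u : Base m n →₀ ℕ} :
    u ∈ exponents m n a b ↔ Finsupp.weight (baseDeg m n) u = (a, b) := by
  rw [weight_eq_iff, exponents, Finset.mem_map_equiv, Equiv.symm_symm]
  simp [Finset.mem_product, Finset.mem_finsuppAntidiag]
  rfl

theorem card_exponents (a b : ℕ) :
    (exponents m n a b).card = (m + a).choose a * (n + b).choose b := by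
  rw [exponents, Finset.card_map, Finset.card_product,
    Finset.card_finsuppAntidiag_nat_eq_choose, Finset.card_finsuppAntidiag_nat_eq_choose]
  simp only [Finset.card_univ, Fintype.card_fin]
  congr 2 <;> omega

/-- The weight of a monomial for the weights `κ` of the coordinates. -/
def expWeight (κ : Base m n → ℤ) (u : Base m n →₀ ℕ) : ℤ := ∑ k, κ k * u k

theorem expWeight_add (κ : Base m n → ℤ) (u v : Base m n →₀ ℕ) :
    expWeight κ (u + v) = expWeight κ u + expWeight κ v := by
  simp [expWeight, mul_add, Finset.sum_add_distrib]

theorem sum_exponents_perm (a b : ℕ) (s : Equiv.Perm (Fin (m + 1)))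
    (s' : Equiv.Perm (Fin (n + 1))) (k : Base m n) :
    ∑ u ∈ exponents m n a b, (u (Equiv.sumCongr s s' k) : ℤ) =
      ∑ u ∈ exponents m n a b, (u k : ℤ) := by
  refine Finset.sum_nbij' (fun u => u.equivMapDomain (Equiv.sumCongr s s').symm)
    (fun u => u.equivMapDomain (Equiv.sumCongr s s')) ?_ ?_ ?_ ?_ ?_
  · intro u hu
    rw [mem_exponents, weight_eq_iff] at *
    refine ⟨?_, ?_⟩
    · rw [← hu.1]
      exact Equiv.sum_comp s fun i => u (Sum.inl i)
    · rw [← hu.2]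
      exact Equiv.sum_comp s' fun i => u (Sum.inr i)
  · intro u hu
    rw [mem_exponents, weight_eq_iff] at *
    refine ⟨?_, ?_⟩
    · rw [← hu.1]
      exact Equiv.sum_comp s.symm fun i => u (Sum.inl i)
    · rw [← hu.2]
      exact Equiv.sum_comp s'.symm fun i => u (Sum.inr i)
  · intro u _
    ext k
    simp [Finsupp.equivMapDomain_apply]
  · intro u _
    ext k
    simp [Finsupp.equivMapDomain_apply]
  · intro u _
    simp [Finsupp.equivMapDomain_apply]

/-- Weights that add up to zero on each factor have total weight zero on the forms of a given
bidegree, by the symmetry of the set of exponents. -/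
theorem sum_expWeight_exponents {κ : Base m n → ℤ} (h₁ : ∑ i, κ (Sum.inl i) = 0)
    (h₂ : ∑ j, κ (Sum.inr j) = 0) (a b : ℕ) :
    ∑ u ∈ exponents m n a b, expWeight κ u = 0 := by
  have e₁ : ∀ i, ∑ u ∈ exponents m n a b, (u (Sum.inl i) : ℤ) =
      ∑ u ∈ exponents m n a b, (u (Sum.inl 0) : ℤ) := fun i => by
    simpa using sum_exponents_perm a b (Equiv.swap 0 i) (Equiv.refl (Fin (n + 1))) (Sum.inl 0)
  have e₂ : ∀ j, ∑ u ∈ exponents m n a b, (u (Sum.inr j) : ℤ) =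
      ∑ u ∈ exponents m n a b, (u (Sum.inr 0) : ℤ) := fun j => by
    simpa using sum_exponents_perm a b (Equiv.refl (Fin (m + 1))) (Equiv.swap 0 j) (Sum.inr 0)
  simp only [expWeight]
  rw [Finset.sum_comm]
  simp only [← Finset.mul_sum, Fintype.sum_sum_type]
  simp only [e₁, e₂, ← Finset.sum_mul, h₁, h₂, zero_mul, add_zero]

/-- The exponents of bidegree `(a, b)` of monomials that are not divisible by the one with
exponent `D`. -/
noncomputable def reducedExponents (D : Base m n →₀ ℕ) (a b : ℕ) : Finset (Base m n →₀ ℕ) := by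
  classical exact (exponents m n a b).filter fun u => ¬ D ≤ u

theorem mem_reducedExponents {D : Base m n →₀ ℕ} {a b : ℕ} {u : Base m n →₀ ℕ} :
    u ∈ reducedExponents D a b ↔ Finsupp.weight (baseDeg m n) u = (a, b) ∧ ¬ D ≤ u := by
  classical
  rw [reducedExponents, Finset.mem_filter, mem_exponents]

theorem sum_reducedExponents {D : Base m n →₀ ℕ} (hD : Finsupp.weight (baseDeg m n) D = (1, 1))
    (a b : ℕ) (F : (Base m n →₀ ℕ) → ℤ) :
    ∑ u ∈ reducedExponents D (a + 1) (b + 1), F u =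
      ∑ u ∈ exponents m n (a + 1) (b + 1), F u - ∑ u ∈ exponents m n a b, F (D + u) := by
  classical
  have h : (exponents m n (a + 1) (b + 1)).filter (fun u => D ≤ u) =
      (exponents m n a b).map (addLeftEmbedding D) := by
    ext u
    simp only [Finset.mem_filter, Finset.mem_map, mem_exponents, addLeftEmbedding_apply]
    constructor
    · rintro ⟨hu, hDu⟩
      obtain ⟨v, rfl⟩ := exists_add_of_le hDu
      refine ⟨v, ?_, rfl⟩
      rw [map_add, hD, Prod.ext_iff] at hu
      simp only [Prod.fst_add, Prod.snd_add] at hu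
      exact Prod.ext (by omega) (by omega)
    · rintro ⟨v, hv, rfl⟩
      refine ⟨?_, le_self_add⟩
      rw [map_add, hD, hv, Prod.mk_add_mk, add_comm 1 a, add_comm 1 b]
  rw [eq_sub_iff_add_eq,
    ← Finset.sum_filter_not_add_sum_filter (exponents m n (a + 1) (b + 1)) (fun u => D ≤ u), h,
    Finset.sum_map]
  simp only [reducedExponents, addLeftEmbedding_apply]

end Monomials

/-! ### A monomial basis of the sections -/

section Basis

variable {K : Type*} [Field K]

/-- The leading exponent `D` of `f` for some monomial order: no nonzero multiple of `f` is reduced,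
that is, free of monomials divisible by that of exponent `D`, and every polynomial has a reduced
remainder. -/
theorem exists_leading_exponent {σ : Type*} [Finite σ] {f : MvPolynomial σ K} (hf : f ≠ 0) :
    ∃ D, coeff D f ≠ 0 ∧ (∀ g, f ∣ g → g ≠ 0 → ∃ u ∈ g.support, D ≤ u) ∧
      ∀ g, ∃ r, f ∣ g - r ∧ ∀ u ∈ r.support, ¬ D ≤ u := by
  have := Fintype.ofFinite σ
  -- Any monomial order will do.
  let _ : LinearOrder σ := LinearOrder.lift' (Fintype.equivFin σ) (Fintype.equivFin σ).injective
  let o : MonomialOrder σ := MonomialOrder.lex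
  refine ⟨o.degree f, mem_support_iff.mp (o.degree_mem_support hf), ?_, fun g => ?_⟩
  · rintro g ⟨q, rfl⟩ hne
    refine ⟨o.degree (f * q), o.degree_mem_support hne, ?_⟩
    rw [o.degree_mul hf (right_ne_zero_of_mul hne)]
    exact le_self_add
  · obtain ⟨q, r, hqr, -, hr⟩ := o.div_single
      (IsUnit.mk0 _ (o.leadingCoeff_ne_zero_iff.mpr hf)) g
    exact ⟨r, ⟨q, by rw [hqr]; ring⟩, hr⟩

variable {m n : ℕ}

theorem exists_reduced_remainder {f : MvPolynomial (Base m n) K} (hf : IsDefining f)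
    {D : Base m n →₀ ℕ} (hD : ∀ g, ∃ r, f ∣ g - r ∧ ∀ u ∈ r.support, ¬ D ≤ u) {a b : ℕ}
    {g : MvPolynomial (Base m n) K} (hg : IsWeightedHomogeneous (baseDeg m n) g (a, b)) :
    ∃ r, f ∣ g - r ∧ r.support ⊆ reducedExponents D a b := by
  classical
  obtain ⟨r, hr, hrD⟩ := hD g
  have hf' := isWeightedHomogeneous_baseDeg.mp hf.2
  have hg' := isWeightedHomogeneous_baseDeg.mp hg
  have h1 : IsWeightedHomogeneous (fun i => (baseDeg m n i).1) (1 : MvPolynomial (Base m n) K) 0 :=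
    isWeightedHomogeneous_one _ _
  have h2 : IsWeightedHomogeneous (fun i => (baseDeg m n i).2) (1 : MvPolynomial (Base m n) K) 0 :=
    isWeightedHomogeneous_one _ _
  have h3 := dvd_sub_weightedHomogeneousComponent_mul hf'.2 h2 hg'.2
    (dvd_sub_weightedHomogeneousComponent_mul hf'.1 h1 hg'.1 (q := r) (by rwa [mul_one]))
  rw [mul_one] at h3
  refine ⟨_, h3, fun u hu => ?_⟩
  rw [mem_support_iff, coeff_weightedHomogeneousComponent, coeff_weightedHomogeneousComponent,
    ite_ne_right_iff, ite_ne_right_iff] at hu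
  rw [mem_reducedExponents, weight_baseDeg, hu.1, hu.2.1]
  exact ⟨rfl, hrD u (mem_support_iff.mpr hu.2.2)⟩

/-- The reduced monomials in the coordinates given by the rows of `A` and `B` form a basis of the
sections. Here `g` is the defining polynomial in these coordinates, and `D` its leading
exponent. -/
theorem exists_basis_sections [IsAlgClosed K] (hm : 1 ≤ m) (hn : 1 ≤ n)
    {f : MvPolynomial (Base m n) K} (hf : IsDefining f) (hp : Prime f)
    {A A' : Matrix (Fin (m + 1)) (Fin (m + 1)) K} {B B' : Matrix (Fin (n + 1)) (Fin (n + 1)) K}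
    (hA : A * A' = 1) (hA' : A' * A = 1) (hB : B * B' = 1) (hB' : B' * B = 1)
    {D : Base m n →₀ ℕ}
    (hD : ∀ g, coordChange A' B' f ∣ g → g ≠ 0 → ∃ u ∈ g.support, D ≤ u)
    (hD' : ∀ g, ∃ r, coordChange A' B' f ∣ g - r ∧ ∀ u ∈ r.support, ¬ D ≤ u) (a b : ℕ) :
    ∃ v : Module.Basis (reducedExponents D a b) K (sections (central f) a b),
      ∀ u, (v u).1 = restrict f (coordChange A B (monomial u.1 1)) := by
  classical
  set f' := coordChange A' B' f with hf'
  have hff' : coordChange A B f' = f := coordChange_coordChange hA' hB' f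
  have hdef : IsDefining f' := by
    refine ⟨fun h0 => hf.1 ?_, isWeightedHomogeneous_coordChange _ _ hf.2⟩
    rw [← hff', h0, map_zero]
  have hdvd : ∀ g, f' ∣ g ↔ f ∣ coordChange A B g := by
    intro g
    constructor
    · intro h
      rw [← hff']
      exact map_dvd _ h
    · intro h
      rw [← coordChange_coordChange hA hB g]
      exact map_dvd _ h
  let v₀ : reducedExponents D a b → sections (central f) a b := fun u =>
    ⟨restrict f (coordChange A B (monomial u.1 1)), restrict_mem_sections
      (isWeightedHomogeneous_coordChange _ _ (isWeightedHomogeneous_monomial _ _ _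
        (mem_reducedExponents.mp u.2).1))⟩
  have hcomb : ∀ c : reducedExponents D a b → K, (∑ u, c u • v₀ u).1 =
      restrict f (coordChange A B (∑ u : reducedExponents D a b, monomial u.1 (c u))) := by
    intro c
    rw [Submodule.coe_sum, map_sum, map_sum]
    refine Finset.sum_congr rfl fun u _ => ?_
    rw [Submodule.coe_smul, ← map_smul, ← map_smul, smul_monomial, smul_eq_mul, mul_one]
  have hcoeff : ∀ (c : reducedExponents D a b → K) (u : reducedExponents D a b),
      coeff u.1 (∑ u : reducedExponents D a b, monomial u.1 (c u)) = c u := by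
    intro c u
    rw [coeff_sum, Finset.sum_eq_single u]
    · simp
    · intro u' _ hne
      rw [coeff_monomial, if_neg fun h => hne (Subtype.ext h)]
    · simp
  have hli : LinearIndependent K v₀ := by
    rw [Fintype.linearIndependent_iff]
    intro c hc
    have h0 := hcomb c
    rw [hc] at h0
    have h1 := (hdvd _).mpr ((restrict_eq_zero_iff hf hp).mp h0.symm)
    have h2 : ∑ u : reducedExponents D a b, monomial u.1 (c u) = 0 := by
      by_contra hne
      obtain ⟨u, hu, hDu⟩ := hD _ h1 hne
      rw [mem_support_iff, coeff_sum] at hu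
      obtain ⟨u', -, hu'⟩ := Finset.exists_ne_zero_of_sum_ne_zero hu
      rw [coeff_monomial, ite_ne_right_iff] at hu'
      exact (mem_reducedExponents.mp u'.2).2 (hu'.1 ▸ hDu)
    intro u
    rw [← hcoeff c u, h2, coeff_zero]
  have hspan : ⊤ ≤ Submodule.span K (Set.range v₀) := by
    rintro s -
    obtain ⟨g, hg, hgs⟩ := exists_restrict_eq hm hn hf hp s.2
    obtain ⟨r, hr, hrs⟩ := exists_reduced_remainder hdef hD'
      (isWeightedHomogeneous_coordChange A' B' hg)
    have h1 : s = ∑ u, coeff u.1 r • v₀ u := by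
      apply Subtype.ext
      rw [hcomb]
      have h2 : ∑ u : reducedExponents D a b, monomial u.1 (coeff u.1 r) = r := by
        rw [Finset.sum_coe_sort (reducedExponents D a b) fun u => monomial u (coeff u r)]
        conv_rhs => rw [r.as_sum]
        refine (Finset.sum_subset hrs fun u _ hu => ?_).symm
        rw [notMem_support_iff.mp hu, map_zero]
      rw [h2, ← hgs, ← sub_eq_zero, ← map_sub, restrict_eq_zero_iff hf hp]
      rw [hdvd, map_sub, coordChange_coordChange hA' hB'] at hr
      exact hr
    rw [h1]
    exact Submodule.sum_mem _ fun u _ => Submodule.smul_mem _ _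
      (Submodule.subset_span (Set.mem_range_self u))
  exact ⟨Module.Basis.mk hli hspan, fun u => by rw [Module.Basis.mk_apply]⟩

end Basis

/-! ### Linearizations on the central fibre -/

section Linearizations

variable {K : Type*} [Field K] {m n : ℕ}

/-- On the central fibre, a linearization of a power of `ℒ` differs from the standard one by
a character of `G_m`: the multiplier is constant along `X`, as a section of `O_X`, and rational
in `t`. -/
theorem exists_multiplier_eq_zpow [IsAlgClosed K] [CharZero K] (hm : 1 ≤ m) (hn : 1 ≤ n)
    {f : MvPolynomial (Base m n) K} (hf : IsDefining f) (hp : Prime f)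
    {l : OneParameterSubgroup K m n} {hl : Preserves l f} (L : Linearization hl) :
    ∃ γ : ℤ, ∀ t z, L.c t (inclCentral f z) = ((t ^ γ : Kˣ) : K) := by
  have hconst : ∀ t, ∃ r, ∀ z, L.c t (inclCentral f z) = r := by
    intro t
    obtain ⟨g, hg, hgc⟩ := exists_restrict_eq hm hn hf hp (linearization_regular L t)
    refine ⟨coeff 0 g, fun z => ?_⟩
    have h1 := congrFun hgc z
    rw [eq_C_of_isWeightedHomogeneous_zero hg] at h1
    simpa [restrict] using h1.symm
  choose c hc using hconst
  by_cases hne : Nonempty (central f)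
  swap
  · exact ⟨0, fun t z => absurd ⟨z⟩ hne⟩
  obtain ⟨z₀⟩ := hne
  let χ : Kˣ →* K :=
    { toFun := c
      map_one' := by rw [← hc 1 z₀, L.map_one]
      map_mul' := fun t t' => by
        have h1 : smulTotal hl t' (inclCentral f z₀) = inclCentral f (smulCentral hl t' z₀) := rfl
        rw [← hc _ z₀, L.map_mul, h1, hc, hc] }
  let P : Kˣ → gmTotal f := fun t =>
    ⟨Sum.elim (fun i => z₀.1 (Sum.inl i)) (fun i => if i = 0 then 0 else (t : K)), z₀.2.1, by simp⟩
  have hP : ∀ t, L.c (Units.mk0 ((P t).1 (Sum.inr 1)) (P t).2.2) (gmSnd f (P t)) = c t := by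
    intro t
    rw [← hc t z₀]
    congr 1
    · ext
      simp [P]
    · apply Subtype.ext
      funext i
      rcases i with i | i
      · rfl
      · rw [Subsingleton.elim i 0]
        exact z₀.2.2.symm
  obtain ⟨_, g, h, -, -, h1, hgh⟩ := L.regular (P 1)
  let Θ : MvPolynomial (Coord m n 2) K →ₐ[K] Polynomial K :=
    aeval (Sum.elim (fun i => Polynomial.C (z₀.1 (Sum.inl i)))
      (fun i => if i = 0 then 0 else Polynomial.X))
  have hΘ : ∀ (t : Kˣ) q, (Θ q).eval (t : K) = eval (P t).1 q := by
    intro t q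
    have : (Polynomial.aeval (t : K)).comp Θ = aeval (P t).1 := by
      ext i
      rcases i with i | i
      · simp [Θ, P]
      · by_cases hi : i = 0 <;> simp [Θ, P, hi]
    rw [← Polynomial.coe_aeval_eq_eval, ← coe_aeval_eq_eval, RingHom.coe_coe, ← this]
    rfl
  obtain ⟨γ, hγ⟩ := exists_eq_zpow_of_rational χ (g := Θ g) (h := Θ h) (fun h0 => h1 (by
    rw [← hΘ, h0, Polynomial.eval_zero])) (fun t ht => by
    rw [hΘ] at ht
    rw [hΘ, hΘ, ← hgh _ ht]
    exact (hP t).symm)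
  exact ⟨γ, fun t z => (hc t z).trans (hγ t)⟩

end Linearizations

/-! ### The weights of the sections over the central fibre -/

section Weights

variable {K : Type*} [Field K] {m n : ℕ}

theorem prod_zpow_pow_eq (κ : Base m n → ℤ) (t : Kˣ) (u : Base m n →₀ ℕ) :
    ∏ k, ((t ^ κ k : Kˣ) : K) ^ u k = ((t ^ expWeight κ u : Kˣ) : K) := by
  rw [expWeight, ← prod_zpow_eq_zpow_sum, Units.coe_prod]
  refine Finset.prod_congr rfl fun k _ => ?_
  rw [zpow_mul, zpow_natCast, Units.val_pow_eq_pow_val]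

theorem coeff_aeval_C_mul_X {σ : Type*} [Fintype σ] (a : σ → K) (g : MvPolynomial σ K)
    (u : σ →₀ ℕ) :
    coeff u (aeval (fun k => C (a k) * X k) g : MvPolynomial σ K) =
      (∏ k, a k ^ u k) * coeff u g := by
  classical
  induction g using MvPolynomial.induction_on' with
  | monomial v c =>
    have h : (aeval (fun k => C (a k) * X k) (monomial v c) : MvPolynomial σ K) =
        C (∏ k, a k ^ v k) * monomial v c := by
      rw [aeval_monomial, monomial_eq, Finsupp.prod_fintype _ _ (by simp),
        Finsupp.prod_fintype _ _ (by simp)]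
      simp only [mul_pow, Finset.prod_mul_distrib, map_prod, map_pow, algebraMap_eq]
      ring
    rw [h, coeff_C_mul, coeff_monomial]
    split_ifs with hu
    · rw [hu]
    · simp
  | add p q hp hq => rw [map_add, coeff_add, hp, hq, coeff_add, mul_add]

/-- The linear forms given by the rows of `A` and `B` are eigenvectors of `λ`: the coordinate of
`λ(t) p` with index `k` is `t ^ κ k` times that of `p`. As functions under `s ↦ s(t⁻¹ ·)`, these
coordinates have weights `-κ`. -/
def IsEigen (l : OneParameterSubgroup K m n) (A : Matrix (Fin (m + 1)) (Fin (m + 1)) K)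
    (B : Matrix (Fin (n + 1)) (Fin (n + 1)) K) (κ : Base m n → ℤ) : Prop :=
  ∀ t, A * (l.toHom t).1.1 = Matrix.diagonal (fun i => ((t ^ κ (Sum.inl i) : Kˣ) : K)) * A ∧
    B * (l.toHom t).2.1 = Matrix.diagonal (fun j => ((t ^ κ (Sum.inr j) : Kˣ) : K)) * B

theorem exists_isEigen [CharZero K] (l : OneParameterSubgroup K m n) :
    ∃ (A A' : Matrix (Fin (m + 1)) (Fin (m + 1)) K) (B B' : Matrix (Fin (n + 1)) (Fin (n + 1)) K)
      (κ : Base m n → ℤ), A * A' = 1 ∧ A' * A = 1 ∧ B * B' = 1 ∧ B' * B = 1 ∧ IsEigen l A B κ ∧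
      ∑ i, κ (Sum.inl i) = 0 ∧ ∑ j, κ (Sum.inr j) = 0 := by
  obtain ⟨A, A', μ, hA, hA', hμ, hμ0⟩ := exists_diagonalization
    ((MonoidHom.fst _ _).comp l.toHom) l.algebraic_left
  obtain ⟨B, B', ν, hB, hB', hν, hν0⟩ := exists_diagonalization
    ((MonoidHom.snd _ _).comp l.toHom) l.algebraic_right
  exact ⟨A, A', B, B', Sum.elim μ ν, hA, hA', hB, hB', fun t => ⟨hμ t, hν t⟩, hμ0, hν0⟩

variable {l : OneParameterSubgroup K m n} {A A' : Matrix (Fin (m + 1)) (Fin (m + 1)) K}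
  {B B' : Matrix (Fin (n + 1)) (Fin (n + 1)) K} {κ : Base m n → ℤ}

theorem IsEigen.eval_act (h : IsEigen l A B κ) (t : Kˣ) (p : Base m n → K)
    (g : MvPolynomial (Base m n) K) :
    eval (act l t p) (coordChange A B g) =
      eval p (coordChange A B (aeval (fun k => C ((t ^ κ k : Kˣ) : K) * X k) g)) := by
  rw [eval_coordChange, eval_coordChange]
  have e : ∀ (q : Base m n → K) (a : Base m n → K), eval q (aeval (fun k => C (a k) * X k) g) =
      eval (fun k => a k * q k) g := by
    intro q a
    rw [← coe_aeval_eq_eval, RingHom.coe_coe, ← AlgHom.comp_apply, comp_aeval,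
      ← coe_aeval_eq_eval, RingHom.coe_coe]
    simp
  rw [e]
  congr 2
  funext k
  rcases k with i | j
  · simp only [act, Sum.elim_inl, Matrix.mulVec_mulVec, (h t).1]
    rw [← Matrix.mulVec_mulVec, Matrix.mulVec_diagonal]
  · simp only [act, Sum.elim_inr, Matrix.mulVec_mulVec, (h t).2]
    rw [← Matrix.mulVec_mulVec, Matrix.mulVec_diagonal]

theorem IsEigen.eval_act_monomial (h : IsEigen l A B κ) (t : Kˣ) (p : Base m n → K)
    (u : Base m n →₀ ℕ) :
    eval (act l t p) (coordChange A B (monomial u 1)) =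
      ((t ^ expWeight κ u : Kˣ) : K) * eval p (coordChange A B (monomial u 1)) := by
  classical
  have e : (aeval (fun k => C ((t ^ κ k : Kˣ) : K) * X k) (monomial u (1 : K)) :
      MvPolynomial (Base m n) K) = ((t ^ expWeight κ u : Kˣ) : K) • monomial u 1 := by
    ext v
    rw [coeff_aeval_C_mul_X, prod_zpow_pow_eq, coeff_smul, coeff_monomial, smul_eq_mul]
    split_ifs with huv
    · rw [huv]
    · simp
  rw [h.eval_act, e, map_smul, smul_eval]

/-- The monomials of `f` in eigencoordinates have the weight `α` of `f`, as functions; the sign is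
that of `IsEigen`. -/
theorem IsEigen.expWeight_eq [CharZero K] (h : IsEigen l A B κ) (hA' : A' * A = 1)
    (hB' : B' * B = 1) (hA : A * A' = 1) (hB : B * B' = 1) {f : MvPolynomial (Base m n) K} {α : ℤ}
    (hα : HasWeight l f α) {u : Base m n →₀ ℕ} (hu : coeff u (coordChange A' B' f) ≠ 0) :
    expWeight κ u = -α := by
  set f' := coordChange A' B' f with hf'
  have hff' : coordChange A B f' = f := coordChange_coordChange hA' hB' f
  let t : Kˣ := Units.mk0 2 two_ne_zero
  have h1 : coordChange A B (aeval (fun k => C ((t⁻¹ ^ κ k : Kˣ) : K) * X k) f') =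
      coordChange A B (((t ^ α : Kˣ) : K) • f') := by
    refine MvPolynomial.funext fun p => ?_
    rw [← h.eval_act, map_smul, smul_eval, hff', hα]
  have h2 := congrArg (coordChange A' B') h1
  rw [coordChange_coordChange hA hB, coordChange_coordChange hA hB] at h2
  have h3 := congrArg (coeff u) h2
  rw [coeff_aeval_C_mul_X, prod_zpow_pow_eq, coeff_smul, smul_eq_mul] at h3
  have h4 := mul_right_cancel₀ hu h3
  rw [inv_zpow', Units.val_zpow_eq_zpow_val, Units.val_zpow_eq_zpow_val, Units.val_mk0] at h4
  have h5 := two_zpow_injective h4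
  omega

/-- Dimension and total weight of the space of sections of bidegree `(a, b)` over the central
fibre: the space is the quotient of the forms of bidegree `(a, b)`, of total weight zero, by the
multiples of `f`, and `f` has weight `α`. -/
theorem finrank_and_totalWeight [IsAlgClosed K] [CharZero K] (hm : 1 ≤ m) (hn : 1 ≤ n)
    {f : MvPolynomial (Base m n) K} (hf : IsDefining f) (hp : Prime f)
    {l : OneParameterSubgroup K m n} {hl : Preserves l f} {α : ℤ} (hα : HasWeight l f α)
    (L : Linearization hl) {γ : ℤ}
    (hγ : ∀ t z, L.c t (inclCentral f z) = ((t ^ γ : Kˣ) : K)) (j a b : ℕ) :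
    (Module.finrank K (sections (central f) (a + 1) (b + 1)) : ℤ) =
        (exponents m n (a + 1) (b + 1)).card - (exponents m n a b).card ∧
      totalWeight (sectionRep L j (a + 1) (b + 1)) =
        γ * j * Module.finrank K (sections (central f) (a + 1) (b + 1)) -
          α * (exponents m n a b).card := by
  obtain ⟨A, A', B, B', κ, hA, hA', hB, hB', hκ, hκ₁, hκ₂⟩ := exists_isEigen l
  have hf' : IsDefining (coordChange A' B' f) := by
    refine ⟨fun h0 => hf.1 ?_, isWeightedHomogeneous_coordChange _ _ hf.2⟩
    rw [← coordChange_coordChange hA' hB' f, h0, map_zero]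
  obtain ⟨D, hD0, hD, hD'⟩ := exists_leading_exponent hf'.1
  have hDw := hf'.2 hD0
  have hDα := hκ.expWeight_eq hA' hB' hA hB hα hD0
  obtain ⟨v, hv⟩ := exists_basis_sections hm hn hf hp hA hA' hB hB' hD hD' (a + 1) (b + 1)
  have hrank : (Module.finrank K (sections (central f) (a + 1) (b + 1)) : ℤ) =
      (reducedExponents D (a + 1) (b + 1)).card := by
    rw [Module.finrank_eq_card_basis v, Fintype.card_coe]
  have hw : ∀ t u, sectionRep L j (a + 1) (b + 1) t (v u) =
      ((t ^ (γ * j - expWeight κ u.1) : Kˣ) : K) • v u := by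
    intro t u
    apply Subtype.ext
    funext z
    change L.c t (inclCentral f (smulCentral hl t⁻¹ z)) ^ j * (v u).1 (smulCentral hl t⁻¹ z) =
      ((t ^ (γ * j - expWeight κ u.1) : Kˣ) : K) * (v u).1 z
    rw [hγ, hv]
    change _ * eval (act l t⁻¹ fun i => z.1 (Sum.inl i)) _ = _ * eval _ _
    rw [hκ.eval_act_monomial, ← mul_assoc, sub_eq_add_neg, zpow_add, zpow_mul, inv_zpow',
      zpow_natCast, Units.val_mul, Units.val_pow_eq_pow_val]
  refine ⟨?_, ?_⟩
  · have h1 := sum_reducedExponents hDw a b fun _ => 1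
    simp only [Finset.sum_const, nsmul_eq_mul, mul_one] at h1
    rw [hrank, h1]
  · rw [totalWeight_eq_sum v hw, hrank,
      Finset.sum_coe_sort (reducedExponents D (a + 1) (b + 1)) fun u => γ * j - expWeight κ u,
      Finset.sum_sub_distrib, sum_reducedExponents hDw a b (expWeight κ),
      sum_expWeight_exponents hκ₁ hκ₂]
    simp only [expWeight_add, Finset.sum_add_distrib, sum_expWeight_exponents hκ₁ hκ₂, hDα,
      Finset.sum_const, nsmul_eq_mul]
    ring

end Weights

end BiProj

namespace BiProj

/-! ### Asymptotics of the dimension and of the total weight -/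

section Asymptotics

open Polynomial

/-- The polynomial in `k` with value `∏ i < m, (d k + i + s) / m!`: the dimension of the space of
forms of degree `d k` in `m + 1` variables for `s = 1`, and of degree `d k - 1` for `s = 0`. -/
noncomputable def dimPoly (m d : ℕ) (s : ℚ) : ℚ[X] :=
  C ((d : ℚ) ^ m / m.factorial) * ∏ i ∈ Finset.range m, (X - C (-((i + s) / d)))

theorem eval_dimPoly {d : ℕ} (hd : 1 ≤ d) (m : ℕ) (s x : ℚ) :
    (dimPoly m d s).eval x =
      (∏ i ∈ Finset.range m, (d * x + i + s)) / m.factorial := by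
  have hd0 : (d : ℚ) ≠ 0 := by positivity
  have h : ∏ i ∈ Finset.range m, (d * x + i + s) =
      (d : ℚ) ^ m * ∏ i ∈ Finset.range m, (x - -((i + s) / d)) := by
    rw [← Finset.card_range m, ← Finset.prod_const, Finset.card_range, ← Finset.prod_mul_distrib]
    refine Finset.prod_congr rfl fun i _ => ?_
    field_simp
    ring
  rw [dimPoly, eval_mul, eval_C, eval_prod, h]
  simp only [eval_sub, eval_X, eval_C]
  ring

theorem cast_choose_eq (m a : ℕ) :
    ((m + a).choose a : ℚ) = (∏ i ∈ Finset.range m, ((a : ℚ) + i + 1)) / m.factorial := by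
  have h1 := Nat.ascFactorial_eq_factorial_mul_choose a m
  rw [Nat.ascFactorial_eq_prod_range, add_comm a m, Nat.choose_symm_add] at h1
  rw [eq_div_iff (by positivity), mul_comm]
  have h2 := congrArg (Nat.cast : ℕ → ℚ) h1
  push_cast at h2
  rw [← h2]
  exact Finset.prod_congr rfl fun i _ => by ring

theorem sum_range_add_div (m d : ℕ) (s : ℚ) :
    ∑ i ∈ Finset.range m, -(((i : ℚ) + s) / d) = -((m * (m - 1) / 2 + m * s) / d) := by
  rw [Finset.sum_neg_distrib, ← Finset.sum_div]
  congr 2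
  induction m with
  | zero => simp
  | succ m ih =>
    rw [Finset.sum_range_succ, ih]
    push_cast
    ring

theorem dimPoly_mul (m n d e : ℕ) (s t : ℚ) :
    dimPoly m d s * dimPoly n e t =
      C ((d : ℚ) ^ m / m.factorial * ((e : ℚ) ^ n / n.factorial)) *
        ∏ i ∈ (Finset.range m).disjSum (Finset.range n),
          (X - C (Sum.elim (fun i : ℕ => -(((i : ℚ) + s) / d))
            (fun i : ℕ => -(((i : ℚ) + t) / e)) i)) := by
  rw [Finset.prod_disjSum, dimPoly, dimPoly, C_mul]
  simp only [Sum.elim_inl, Sum.elim_inr]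
  ring

theorem natDegree_dimPoly_mul_le (m n d e : ℕ) (s t : ℚ) :
    (dimPoly m d s * dimPoly n e t).natDegree ≤ m + n := by
  rw [dimPoly_mul]
  refine (natDegree_C_mul_le _ _).trans ?_
  rw [natDegree_finsetProd_X_sub_C_eq_card, Finset.card_disjSum, Finset.card_range,
    Finset.card_range]

theorem coeff_dimPoly_mul (m n d e : ℕ) (s t : ℚ) :
    (dimPoly m d s * dimPoly n e t).coeff (m + n) =
      (d : ℚ) ^ m / m.factorial * ((e : ℚ) ^ n / n.factorial) := by
  rw [dimPoly_mul, coeff_C_mul]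
  have h := (monic_prod_X_sub_C (Sum.elim (fun i : ℕ => -(((i : ℚ) + s) / d))
    (fun i : ℕ => -(((i : ℚ) + t) / e)))
    ((Finset.range m).disjSum (Finset.range n))).coeff_natDegree
  rw [natDegree_finsetProd_X_sub_C_eq_card, Finset.card_disjSum, Finset.card_range,
    Finset.card_range] at h
  rw [h, mul_one]

theorem coeff_pred_dimPoly_mul {m n : ℕ} (d e : ℕ) (s t : ℚ) {k : ℕ} (hk : m + n = k + 1) :
    (dimPoly m d s * dimPoly n e t).coeff k =
      (d : ℚ) ^ m / m.factorial * ((e : ℚ) ^ n / n.factorial) *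
        ((m * (m - 1) / 2 + m * s) / d + (n * (n - 1) / 2 + n * t) / e) := by
  rw [dimPoly_mul, coeff_C_mul]
  have hcard : ((Finset.range m).disjSum (Finset.range n)).card = k + 1 := by
    rw [Finset.card_disjSum, Finset.card_range, Finset.card_range, hk]
  have h := prod_X_sub_C_coeff_card_pred ((Finset.range m).disjSum (Finset.range n))
    (Sum.elim (fun i : ℕ => -(((i : ℚ) + s) / d)) (fun i : ℕ => -(((i : ℚ) + t) / e)))
    (by rw [hcard]; omega)
  rw [hcard, Nat.add_sub_cancel] at h
  rw [h, Finset.sum_disjSum]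
  simp only [Sum.elim_inl, Sum.elim_inr, sum_range_add_div]
  ring

/-- Expansion of the dimension `h(dk, ek) - h(dk-1, ek-1)` and of the total weight. By Pascal's
rule the dimension is a sum of two products of degree `m + n - 1`, for which only the two leading
coefficients are needed. -/
theorem isDonaldsonFutaki_of_eq {m n d e r : ℕ} (hm : 1 ≤ m) (hn : 1 ≤ n) (hd : 1 ≤ d)
    (he : 1 ≤ e) (hr : 1 ≤ r) {N : ℕ → ℕ} {w : ℕ → ℤ} {α γ : ℤ}
    (hN : ∀ k a b, d * k = a + 1 → e * k = b + 1 → (N k : ℤ) =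
      ((m + (a + 1)).choose (a + 1) * (n + (b + 1)).choose (b + 1) : ℕ) -
        ((m + a).choose a * (n + b).choose b : ℕ))
    (hw : ∀ k a b, d * k = a + 1 → e * k = b + 1 → w k =
      γ * (k / r : ℕ) * N k - α * ((m + a).choose a * (n + b).choose b : ℕ)) :
    IsDonaldsonFutaki (m + n - 1) N w
      (-(2 * m * n * d * e : ℚ) / ((m * e + n * d : ℚ) ^ 2) * (α : ℚ)) := by
  obtain ⟨m, rfl⟩ : ∃ m', m = m' + 1 := ⟨m - 1, by omega⟩
  obtain ⟨n, rfl⟩ : ∃ n', n = n' + 1 := ⟨n - 1, by omega⟩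
  have hδ : m + 1 + (n + 1) - 1 = m + n + 1 := by omega
  have hδ' : m + n + 1 - 1 = m + n := by omega
  have hd0 : (d : ℚ) ≠ 0 := by positivity
  have he0 : (e : ℚ) ≠ 0 := by positivity
  have hr0 : (r : ℚ) ≠ 0 := by positivity
  let P : ℚ[X] := dimPoly m d 1 * dimPoly (n + 1) e 1 + dimPoly (m + 1) d 0 * dimPoly n e 1
  let Q : ℚ[X] := C ((γ : ℚ) / r) * (X * P) - C (α : ℚ) *
    (dimPoly (m + 1) d 0 * dimPoly (n + 1) e 0)
  have hP1 : P.natDegree ≤ m + n + 1 := by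
    refine natDegree_add_le_of_degree_le ?_ ?_
    · exact (natDegree_dimPoly_mul_le _ _ _ _ _ _).trans (by omega)
    · exact (natDegree_dimPoly_mul_le _ _ _ _ _ _).trans (by omega)
  have hQ1 : Q.natDegree ≤ m + n + 1 + 1 := by
    refine (natDegree_sub_le _ _).trans (max_le ?_ ?_)
    · refine (natDegree_C_mul_le _ _).trans (natDegree_mul_le.trans ?_)
      rw [natDegree_X]
      omega
    · exact (natDegree_C_mul_le _ _).trans
        ((natDegree_dimPoly_mul_le _ _ _ _ _ _).trans (by omega))
  have hPtop : P.coeff (m + n + 1) =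
      (d : ℚ) ^ m / m.factorial * ((e : ℚ) ^ (n + 1) / (n + 1).factorial) +
      (d : ℚ) ^ (m + 1) / (m + 1).factorial * ((e : ℚ) ^ n / n.factorial) := by
    have h1 := coeff_dimPoly_mul m (n + 1) d e 1 1
    have h2 := coeff_dimPoly_mul (m + 1) n d e 0 1
    rw [← add_assoc] at h1
    rw [add_right_comm] at h2
    rw [coeff_add, h1, h2]
  have hPnext := congrArg₂ (· + ·)
    (coeff_pred_dimPoly_mul (m := m) (n := n + 1) d e 1 1 (k := m + n) (by omega))
    (coeff_pred_dimPoly_mul (m := m + 1) (n := n) d e 0 1 (k := m + n) (by omega))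
  have hQtop : Q.coeff (m + n + 1 + 1) = γ / r * P.coeff (m + n + 1) - α *
      ((d : ℚ) ^ (m + 1) / (m + 1).factorial * ((e : ℚ) ^ (n + 1) / (n + 1).factorial)) := by
    have h1 := coeff_dimPoly_mul (m + 1) (n + 1) d e 0 0
    rw [show m + 1 + (n + 1) = m + n + 1 + 1 by omega] at h1
    rw [coeff_sub, coeff_C_mul, coeff_C_mul, coeff_X_mul, h1]
  have hQnext : Q.coeff (m + n + 1) = γ / r * P.coeff (m + n) -
      α * (dimPoly (m + 1) d 0 * dimPoly (n + 1) e 0).coeff (m + n + 1) := by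
    rw [coeff_sub, coeff_C_mul, coeff_C_mul, coeff_X_mul]
  rw [coeff_pred_dimPoly_mul (m := m + 1) (n := n + 1) d e 0 0 (k := m + n + 1) (by omega)]
    at hQnext
  simp only [← coeff_add] at hPnext
  change P.coeff (m + n) = _ at hPnext
  rw [hδ]
  refine ⟨P, Q, hP1, hQ1, ⟨r, hr, fun k hk hrk => ?_⟩, ?_, ?_⟩
  · obtain ⟨a, ha⟩ : ∃ a, d * k = a + 1 := ⟨d * k - 1, by have := Nat.mul_pos hd hk; omega⟩
    obtain ⟨b, hb⟩ : ∃ b, e * k = b + 1 := ⟨e * k - 1, by have := Nat.mul_pos he hk; omega⟩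
    have ha' : (d : ℚ) * k = a + 1 := by exact_mod_cast ha
    have hb' : (e : ℚ) * k = b + 1 := by exact_mod_cast hb
    have e1 : ∀ m, (dimPoly m d 1).eval (k : ℚ) = ((m + (a + 1)).choose (a + 1) : ℚ) := by
      intro m
      rw [eval_dimPoly hd, cast_choose_eq, ha']
      push_cast
      rfl
    have e2 : ∀ n, (dimPoly n e 1).eval (k : ℚ) = ((n + (b + 1)).choose (b + 1) : ℚ) := by
      intro n
      rw [eval_dimPoly he, cast_choose_eq, hb']
      push_cast
      rfl
    have e3 : ∀ m, (dimPoly m d 0).eval (k : ℚ) = ((m + a).choose a : ℚ) := by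
      intro m
      rw [eval_dimPoly hd, cast_choose_eq, ha']
      exact congrArg (· / _) (Finset.prod_congr rfl fun i _ => by ring)
    have e4 : ∀ n, (dimPoly n e 0).eval (k : ℚ) = ((n + b).choose b : ℚ) := by
      intro n
      rw [eval_dimPoly he, cast_choose_eq, hb']
      exact congrArg (· / _) (Finset.prod_congr rfl fun i _ => by ring)
    have p1 : ((m + 1 + (a + 1)).choose (a + 1) : ℚ) =
        (m + 1 + a).choose a + (m + (a + 1)).choose (a + 1) := by
      rw [show m + 1 + (a + 1) = (m + 1 + a) + 1 by omega, Nat.choose_succ_succ,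
        show m + 1 + a = m + (a + 1) by omega]
      push_cast
      rfl
    have p2 : ((n + 1 + (b + 1)).choose (b + 1) : ℚ) =
        (n + 1 + b).choose b + (n + (b + 1)).choose (b + 1) := by
      rw [show n + 1 + (b + 1) = (n + 1 + b) + 1 by omega, Nat.choose_succ_succ,
        show n + 1 + b = n + (b + 1) by omega]
      push_cast
      rfl
    have hNk : (N k : ℚ) = P.eval (k : ℚ) := by
      have h1 := congrArg (Int.cast : ℤ → ℚ) (hN k a b ha hb)
      push_cast at h1
      rw [h1, eval_add, eval_mul, eval_mul, e1, e2, e2, e3, p1, p2]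
      ring
    refine ⟨hNk, ?_⟩
    have hkr : (((k / r : ℕ) : ℤ) : ℚ) = k / r := by
      rw [Int.cast_natCast, Nat.cast_div hrk hr0]
    rw [hw k a b ha hb, Int.cast_sub, Int.cast_mul, Int.cast_mul, hkr, eval_sub,
      eval_mul, eval_mul, eval_mul, eval_mul, eval_C, eval_C, eval_X, ← hNk,
      e3, e4]
    push_cast
    ring
  · rw [hPtop]
    positivity
  · rw [hδ', hQtop, hQnext, hPtop, hPnext]
    have hfm : (m.factorial : ℚ) ≠ 0 := by positivity
    have hfn : (n.factorial : ℚ) ≠ 0 := by positivity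
    have hm0 : (m : ℚ) + 1 ≠ 0 := by positivity
    have hn0 : (n : ℚ) + 1 ≠ 0 := by positivity
    have hs : ((m : ℚ) + 1) * e + (n + 1) * d ≠ 0 := by positivity
    set x : ℚ := (d : ℚ) ^ m / m.factorial with hx
    set y : ℚ := (e : ℚ) ^ n / n.factorial with hy
    have hx' : (d : ℚ) ^ (m + 1) / (m + 1).factorial = x * (d / (m + 1)) := by
      rw [hx, Nat.factorial_succ, pow_succ]
      push_cast
      field_simp
    have hy' : (e : ℚ) ^ (n + 1) / (n + 1).factorial = y * (e / (n + 1)) := by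
      rw [hy, Nat.factorial_succ, pow_succ]
      push_cast
      field_simp
    have hx0 : x ≠ 0 := by positivity
    have hy0 : y ≠ 0 := by positivity
    rw [hx', hy']
    have htop : x * (y * (e / (n + 1))) + x * (d / (m + 1)) * y =
        x * y * (((m : ℚ) + 1) * e + (n + 1) * d) / ((m + 1) * (n + 1)) := by
      field_simp
    rw [htop]
    push_cast
    field_simp
    ring

end Asymptotics

end BiProj

theorem theorem2 {K : Type*} [Field K] [IsAlgClosed K] [CharZero K]
    (m n : ℕ) (hm : 1 ≤ m) (hn : 1 ≤ n)
    (f : MvPolynomial (BiProj.Base m n) K) (hf : BiProj.IsDefining f)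
    (hX : BiProj.IsNormalHypersurface f)
    (l : BiProj.OneParameterSubgroup K m n) (hl : BiProj.Preserves l f)
    (α : ℤ) (hα : BiProj.HasWeight l f α)
    (d e : ℕ) (hd : 1 ≤ d) (he : 1 ≤ e)
    (r : ℕ) (hr : 1 ≤ r) (L : BiProj.Linearization hl) :
    BiProj.ProductDF d e r L
      (-(2 * m * n * d * e : ℚ) / ((m * e + n * d : ℚ) ^ 2) * (α : ℚ)) := by
  have hp := (BiProj.irreducible_of_isNormalHypersurface hm hn hf hX).prime
  obtain ⟨γ, hγ⟩ := BiProj.exists_multiplier_eq_zpow hm hn hf hp L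
  refine BiProj.isDonaldsonFutaki_of_eq hm hn hd he hr (γ := γ) ?_ ?_
  · intro k a b ha hb
    have h := (BiProj.finrank_and_totalWeight hm hn hf hp hα L hγ 0 a b).1
    rw [BiProj.card_exponents, BiProj.card_exponents] at h
    rw [ha, hb]
    exact h
  · intro k a b ha hb
    have h := (BiProj.finrank_and_totalWeight hm hn hf hp hα L hγ (k / r) a b).2
    rw [BiProj.card_exponents] at h
    rw [ha, hb]
    exact h
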